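/- Let $f:\mathbb{R}^n\to\mathbb{R}$ and $g:\mathbb{R}^m\to\mathbb{R}$ be convex and twice continuously differentiable, let $K:\mathbb{R}^n\to\mathbb{R}^m$ be linear, put $\mathcal{L}(x,y)=f(x)+\langle Kx,y\rangle-g(y)$, and assume that the set $\Omega$ of saddle points of $\mathcal{L}$ (points $(x^*,y^*)$ with $\mathcal{L}(x^*,y)\le\mathcal{L}(x^*,y^*)\le\mathcal{L}(x,y^*)$ for all $x,y$) is nonempty. Let $\alpha>1$, $\gamma>0$, $0<q<1$, $s>0$, $c>0$, $t_0>0$ with $t_0>(\gamma q)^{1/(s+1)}$, and $0<p<1$ with $$p-2q-s<0,\qquad 4q+s+p-2<0,\qquad 3q+s-p-1<0 .$$ For $t\ge t_0$ let $$\mathcal{L}_t(x,y)=\mathcal{L}(x,y)+\frac{c}{2t^p}\left(\|x\|^2-\|y\|^2\right),\qquad \theta(t)=\frac{t^{2q+s}-2\gamma q\,t^{2q-1}+\gamma t^q}{(\alpha-1)\left(t^{q+s}-\gamma q\,t^{q-1}\right)},$$ and let $(x_t,y_t)$ be the saddle point of $\mathcal{L}_t$. Let $(x,y):[t_0,+\infty)\to\mathbb{R}^n\times\mathbb{R}^m$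 be a global (twice differentiable) solution of $$\begin{cases}\ddot x(t)+\frac{\alpha}{t^q}\dot x(t)+\gamma\frac{d}{dt}\big(\nabla_x\mathcal{L}_t(x(t),y(t)+\theta(t)\dot y(t))\big)+t^s\nabla_x\mathcal{L}_t(x(t),y(t)+\theta(t)\dot y(t))=0,\\[2pt] \ddot y(t)+\frac{\alpha}{t^q}\dot y(t)-\gamma\frac{d}{dt}\big(\nabla_y\mathcal{L}_t(x(t)+\theta(t)\dot x(t),y(t))\big)-t^s\nabla_y\mathcal{L}_t(x(t)+\theta(t)\dot x(t),y(t))=0.\end{cases}$$ Then $\Omega$ has a unique element $(\bar x^*,\bar y^*)=\mathrm{Proj}_\Omega 0$ of minimal norm, where $\|(x,y)\|=\sqrt{\|x\|^2+\|y\|^2}$, and $$\lim_{t\to+\infty}\|(x(t),y(t))-(\bar x^*,\bar y^*)\|=0 .$$ Moreover, as $t\to+\infty$: (i) if $q+2p\ge 1$, then $$\mathcal{L}_t(x(t),y_t)-\mathcal{L}_t(x_t,y(t))=\mathcal{O}\left(\frac{1}{t^{2-2q-p}}\right),\qquad \|x(t)-x_t\|+\|y(t)-y_t\|=\mathcal{O}\left(\frac{1}{t^{1-2q-\frac12(s+p)}}\right);$$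 (ii) if $q+2p<1$, then $$\mathcal{L}_t(x(t),y_t)-\mathcal{L}_t(x_t,y(t))=\mathcal{O}\left(\frac{1}{t^{1-q+p}}\right),\qquad \|x(t)-x_t\|+\|y(t)-y_t\|=\mathcal{O}\left(\frac{1}{t^{\frac12(1+p-s)-\frac32 q}}\right).$$ -/

import Mathlib

open Set Filter Topology Asymptotics

noncomputable section

namespace SaddleDynamics

/-- The bilinearly coupled Lagrangian `L(x, y) = f(x) + ⟨K x, y⟩ - g(y)`. -/
def lagrangian {n m : ℕ} (f : EuclideanSpace ℝ (Fin n) → ℝ) (g : EuclideanSpace ℝ (Fin m) → ℝ)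
    (K : EuclideanSpace ℝ (Fin n) →L[ℝ] EuclideanSpace ℝ (Fin m))
    (x : EuclideanSpace ℝ (Fin n)) (y : EuclideanSpace ℝ (Fin m)) : ℝ :=
  f x + inner ℝ (K x) y - g y

/-- The Tikhonov regularized Lagrangian
`L_t(x, y) = L(x, y) + c / (2 t ^ p) * (‖x‖ ^ 2 - ‖y‖ ^ 2)`. -/
def regLagrangian {n m : ℕ} (f : EuclideanSpace ℝ (Fin n) → ℝ)
    (g : EuclideanSpace ℝ (Fin m) → ℝ)
    (K : EuclideanSpace ℝ (Fin n) →L[ℝ] EuclideanSpace ℝ (Fin m)) (c p t : ℝ)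
    (x : EuclideanSpace ℝ (Fin n)) (y : EuclideanSpace ℝ (Fin m)) : ℝ :=
  lagrangian f g K x y + c / (2 * t ^ p) * (‖x‖ ^ 2 - ‖y‖ ^ 2)

/-- `(x₀, y₀)` is a saddle point of `Φ` (minimized in the first variable, maximized in the
second). -/
def IsSaddlePoint {X Y : Type*} (Φ : X → Y → ℝ) (x₀ : X) (y₀ : Y) : Prop :=
  ∀ x y, Φ x₀ y ≤ Φ x₀ y₀ ∧ Φ x₀ y₀ ≤ Φ x y₀

/-- The set of saddle points, as a subset of the product with the Euclidean norm
`‖(x, y)‖ = √(‖x‖ ^ 2 + ‖y‖ ^ 2)`. -/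
def saddleSet {X Y : Type*} (Φ : X → Y → ℝ) : Set (WithLp 2 (X × Y)) :=
  {z | IsSaddlePoint Φ z.fst z.snd}

/-- The set of the points of `D` that are closest to the origin. -/
def projZero {Z : Type*} [Norm Z] (D : Set Z) : Set Z :=
  {z | z ∈ D ∧ ∀ w ∈ D, ‖z‖ ≤ ‖w‖}

/-- The gradient of `Φ` with respect to the first variable. -/
def gradFst {n m : ℕ} (Φ : EuclideanSpace ℝ (Fin n) → EuclideanSpace ℝ (Fin m) → ℝ)
    (x : EuclideanSpace ℝ (Fin n)) (y : EuclideanSpace ℝ (Fin m)) : EuclideanSpace ℝ (Fin n) :=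
  gradient (fun u => Φ u y) x

/-- The gradient of `Φ` with respect to the second variable. -/
def gradSnd {n m : ℕ} (Φ : EuclideanSpace ℝ (Fin n) → EuclideanSpace ℝ (Fin m) → ℝ)
    (x : EuclideanSpace ℝ (Fin n)) (y : EuclideanSpace ℝ (Fin m)) : EuclideanSpace ℝ (Fin m) :=
  gradient (fun v => Φ x v) y

/-- The extrapolation parameter. -/
def extrap (α γ q s t : ℝ) : ℝ :=
  (t ^ (2 * q + s) - 2 * γ * q * t ^ (2 * q - 1) + γ * t ^ q) /
    ((α - 1) * (t ^ (q + s) - γ * q * t ^ (q - 1)))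

/-- `(x, y) : [t₀, ∞) → ℝⁿ × ℝᵐ` is a (classical) global solution of the Tikhonov regularized
second-order primal-dual system with Hessian-driven damping. All derivatives are taken within
`[t₀, ∞)`, so they are one-sided at `t₀`, and values for `t < t₀` play no role. -/
structure IsGlobalSolution {n m : ℕ} (f : EuclideanSpace ℝ (Fin n) → ℝ)
    (g : EuclideanSpace ℝ (Fin m) → ℝ)
    (K : EuclideanSpace ℝ (Fin n) →L[ℝ] EuclideanSpace ℝ (Fin m))
    (α γ q s c p t₀ : ℝ)
    (x : ℝ → EuclideanSpace ℝ (Fin n)) (y : ℝ → EuclideanSpace ℝ (Fin m)) : Prop where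
  differentiable_x : DifferentiableOn ℝ x (Ici t₀)
  differentiable_y : DifferentiableOn ℝ y (Ici t₀)
  differentiable_deriv_x : DifferentiableOn ℝ (derivWithin x (Ici t₀)) (Ici t₀)
  differentiable_deriv_y : DifferentiableOn ℝ (derivWithin y (Ici t₀)) (Ici t₀)
  eq_x : ∀ t, t₀ ≤ t →
    derivWithin (derivWithin x (Ici t₀)) (Ici t₀) t
      + (α / t ^ q) • derivWithin x (Ici t₀) t
      + γ • derivWithin (fun τ => gradFst (regLagrangian f g K c p τ)
          (x τ) (y τ + extrap α γ q s τ • derivWithin y (Ici t₀) τ)) (Ici t₀) t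
      + t ^ s • gradFst (regLagrangian f g K c p t)
          (x t) (y t + extrap α γ q s t • derivWithin y (Ici t₀) t) = 0
  eq_y : ∀ t, t₀ ≤ t →
    derivWithin (derivWithin y (Ici t₀)) (Ici t₀) t
      + (α / t ^ q) • derivWithin y (Ici t₀) t
      - γ • derivWithin (fun τ => gradSnd (regLagrangian f g K c p τ)
          (x τ + extrap α γ q s τ • derivWithin x (Ici t₀) τ) (y τ)) (Ici t₀) t
      - t ^ s • gradSnd (regLagrangian f g K c p t)
          (x t + extrap α γ q s t • derivWithin x (Ici t₀) t) (y t) = 0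

end SaddleDynamics

end

/-! Stack the variables: on the Euclidean product put z = (x, y), A = (∇f, ∇g), which is monotone,
and J(x, y) = (Kᵀy, -Kx), which is skew. Saddle points of L are the zeros of A + J, saddle points
ζ(t) of L_t are zeros of A + ε(t) + J with ε(t) = c / t ^ p, and the system becomes the single
equation z'' + (α / t ^ q) z' + γ Γ' + t ^ s Γ = 0, where Γ = A z + ε z + J (z + θ z').

Convergence splits into ζ → minimal-norm zero and z - ζ → 0. The former is Tikhonov regularization
(`IsMonotoneOp.exists_tendsto`); moreover ‖ζ'‖ ≤ p R / t, where R bounds ‖ζ‖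
(`IsMonotoneOp.exists_hasDerivAt`). For the latter put u = z - ζ, a = α - 1, and let σ be the
numerator of θ. The energy E = σ · gap + ½‖a u + t ^ q (z' + γ Γ)‖² + (a / 2)(1 - q t ^ (q - 1))‖u‖²
is built so that the cross terms of E' cancel (`energy_rate_identity`). What remains is dissipation,
which dominates a multiple of t ^ (-q) E (`energy_le`), and forcing by the drift of ε and ζ,
absorbed up to C t ^ (3q + s + p - 2) (`energy_rate_le`). The comparison lemma
`eventually_le_rpow_of_deriv_le` gives E ≤ M t ^ (4q + s + p - 2). As σ is of order t ^ (2q + s),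
the gap is O(t ^ (2q + p - 2)) and ‖u‖² is O(t ^ (4q + s + p - 2)). These are the rates of (i), and
they imply those of (ii) when q + 2p < 1. -/

noncomputable section
namespace SaddleDynamics

/-! ### Powers of t and a scalar differential inequality. -/

theorem eventually_mul_rpow_le_rpow {a b : ℝ} (hab : a < b) (C : ℝ) :
    ∀ᶠ t : ℝ in atTop, C * t ^ a ≤ t ^ b := by
  have h := (tendsto_rpow_atTop (sub_pos.2 hab)).eventually_ge_atTop C
  filter_upwards [h, eventually_gt_atTop 0] with t h1 h2
  calc C * t ^ a ≤ t ^ (b - a) * t ^ a := by gcongr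
    _ = t ^ b := by rw [← Real.rpow_add h2]; congr 1; ring

/-- The two sides differ by the square (2δ t ^ w U - k t ^ e)² / (4δ t ^ w). It trades a linear
forcing term for a share of the dissipation plus a pure power of t. -/
theorem rpow_mul_le_young {t : ℝ} (ht : 0 < t) {δ : ℝ} (hδ : 0 < δ) (k e w U : ℝ) :
    k * t ^ e * U ≤ δ * t ^ w * U ^ 2 + k ^ 2 / (4 * δ) * t ^ (2 * e - w) := by
  have h1 : t ^ (2 * e - w) = t ^ e * t ^ e / t ^ w := by
    rw [← Real.rpow_add ht, ← Real.rpow_sub ht]; congr 1; ring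
  have hw : 0 < t ^ w := Real.rpow_pos_of_pos ht w
  rw [h1]
  have : δ * t ^ w * U ^ 2 + k ^ 2 / (4 * δ) * (t ^ e * t ^ e / t ^ w) - k * t ^ e * U
      = (2 * δ * t ^ w * U - k * t ^ e) ^ 2 / (4 * δ * t ^ w) := by
    field_simp; ring
  have h2 : 0 ≤ (2 * δ * t ^ w * U - k * t ^ e) ^ 2 / (4 * δ * t ^ w) := by positivity
  linarith

/-- A Gronwall-type comparison for `E' ≤ -κ t ^ (-q) E + C t ^ (r - q)` with `q < 1`. -/
theorem eventually_le_rpow_of_deriv_le {E E' : ℝ → ℝ} {κ C q r : ℝ} (hκ : 0 < κ) (hq : q < 1)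
    (hE : ∀ᶠ t in atTop, HasDerivAt E (E' t) t)
    (h : ∀ᶠ t in atTop, E' t ≤ -κ * t ^ (-q) * E t + C * t ^ (r - q)) :
    ∃ M, 0 < M ∧ ∀ᶠ t in atTop, E t ≤ M * t ^ r := by
  -- As q < 1, the barrier's own derivative, of order t ^ (r - 1), is negligible against t ^ (r -
  -- q).
  have h3 := eventually_mul_rpow_le_rpow (a := r - 1) (b := r - q) (by linarith) (2 * |r| / κ)
  obtain ⟨T, hT⟩ := eventually_atTop.1 ((hE.and h).and (h3.and (eventually_gt_atTop 0)))
  obtain ⟨-, -, hT0⟩ := hT T le_rfl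
  have hTr : 0 < T ^ r := Real.rpow_pos_of_pos hT0 r
  -- In the barrier `M * t ^ r`, `4 * C / κ` lets the damping beat the source, `E T / T ^ r` places
  -- the barrier above E at T, and 1 keeps it positive.
  set M := max 1 (max (4 * C / κ) (E T / T ^ r)) with hM
  have hM0 : 0 < M := lt_of_lt_of_le one_pos (le_max_left _ _)
  have hM1 : 4 * C / κ ≤ M := (le_max_left _ _).trans (le_max_right _ _)
  have hM2 : E T / T ^ r ≤ M := (le_max_right _ _).trans (le_max_right _ _)
  refine ⟨M, hM0, eventually_atTop.2 ⟨T, fun b hb => ?_⟩⟩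
  refine image_le_of_deriv_right_lt_deriv_boundary' (a := T) (b := b) (f := E) (f' := E')
    (B := fun t => M * t ^ r) (B' := fun t => M * (r * t ^ (r - 1))) ?_ ?_ ?_ ?_ ?_ ?_
    (right_mem_Icc.2 hb)
  · intro t ht
    exact (hT t ht.1).1.1.continuousAt.continuousWithinAt
  · intro t ht
    exact (hT t ht.1).1.1.hasDerivWithinAt
  · exact (div_le_iff₀ hTr).1 hM2
  · intro t ht
    exact (((Real.hasDerivAt_rpow_const
      (Or.inl (hT t ht.1).2.2.ne')).const_mul M).continuousAt).continuousWithinAt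
  · intro t ht
    exact ((Real.hasDerivAt_rpow_const (Or.inl (hT t ht.1).2.2.ne')).const_mul M).hasDerivWithinAt
  -- Slopes are compared only where E touches the barrier, so `E t` may be replaced by the barrier.
  · intro t ht heq
    obtain ⟨⟨-, h1⟩, h2, h0⟩ := hT t ht.1
    have hp : 0 < t ^ (r - q) := Real.rpow_pos_of_pos h0 _
    have hp1 : 0 < t ^ (r - 1) := Real.rpow_pos_of_pos h0 _
    have e1 : t ^ (-q) * t ^ r = t ^ (r - q) := by
      rw [← Real.rpow_add h0]; congr 1; ring
    rw [heq] at h1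
    have e2 : -κ * t ^ (-q) * (M * t ^ r) = -κ * M * t ^ (r - q) := by rw [← e1]; ring
    rw [e2] at h1
    have hC : 4 * C ≤ M * κ := (div_le_iff₀ hκ).1 hM1
    have h4 : 2 * |r| * t ^ (r - 1) ≤ κ * t ^ (r - q) := by
      have := mul_le_mul_of_nonneg_left h2 hκ.le
      calc 2 * |r| * t ^ (r - 1) = κ * (2 * |r| / κ * t ^ (r - 1)) := by field_simp
        _ ≤ _ := this
    have h5 : -|r| * t ^ (r - 1) ≤ r * t ^ (r - 1) := by
      gcongr; exact neg_abs_le r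
    have h6 := mul_le_mul_of_nonneg_left h5 hM0.le
    have h7 := mul_le_mul_of_nonneg_left h4 hM0.le
    have h8 := mul_le_mul_of_nonneg_right hC hp.le
    have h9 : 0 < M * κ * t ^ (r - q) := by positivity
    nlinarith


/-! ### The Tikhonov path: zeros of A + J + ε. -/

section Tikhonov

variable {H : Type*} [NormedAddCommGroup H] [InnerProductSpace ℝ H]

/-- `A` is a monotone operator. -/
def IsMonotoneOp (A : H → H) : Prop := ∀ v w, 0 ≤ inner ℝ (A v - A w) (v - w)

/-- `J` is a skew-symmetric operator. -/
def IsSkewOp (J : H →L[ℝ] H) : Prop := ∀ v, inner ℝ (J v) v = 0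

theorem IsSkewOp.inner_comm {J : H →L[ℝ] H} (hJ : IsSkewOp J) (v w : H) :
    inner ℝ (J v) w = -inner ℝ (J w) v := by
  have h := hJ (v + w)
  rw [map_add, inner_add_left, inner_add_right, inner_add_right, hJ v, hJ w] at h
  linarith

variable {A : H → H} {J : H →L[ℝ] H}

/-- Zeros of `A + J + ε` satisfy the variational inequality of the projection of `0`. -/
theorem IsMonotoneOp.inner_sub_nonpos (hA : IsMonotoneOp A) (hJ : IsSkewOp J) {ε : ℝ}
    (hε : 0 < ε) {v w : H} (hv : A v + ε • v + J v = 0) (hw : A w + J w = 0) :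
    inner ℝ v (v - w) ≤ 0 := by
  have h1 := hA v w
  have h2 : A v - A w = -(ε • v) - J (v - w) := by
    have e1 : A v = -(ε • v) - J v := by
      rw [← sub_eq_zero, ← hv]; abel
    have e2 : A w = - J w := eq_neg_of_add_eq_zero_left hw
    rw [e1, e2, map_sub]; abel
  rw [h2, inner_sub_left, hJ (v - w), inner_neg_left, real_inner_smul_left] at h1
  have : 0 ≤ ε * (- inner ℝ v (v - w)) := by linarith
  have := nonneg_of_mul_nonneg_right this hε
  linarith

theorem norm_le_of_inner_sub_nonpos {v w : H} (h : inner ℝ v (v - w) ≤ 0) : ‖v‖ ≤ ‖w‖ := by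
  rw [inner_sub_right, real_inner_self_eq_norm_sq] at h
  have h2 := real_inner_le_norm v w
  by_contra hlt
  push Not at hlt
  nlinarith [norm_nonneg v, norm_nonneg w]

/-- The surplus ‖w - v‖² yields minimality of the norm and uniqueness of the minimizer at once. -/
theorem norm_sq_add_le_of_inner_sub_nonpos {v w : H} (h : inner ℝ v (v - w) ≤ 0) :
    ‖v‖ ^ 2 + ‖w - v‖ ^ 2 ≤ ‖w‖ ^ 2 := by
  rw [inner_sub_right, real_inner_self_eq_norm_sq] at h
  rw [norm_sub_sq_real, real_inner_comm]
  linarith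

/-- Dependence of the zero of `A + J + ε` on `ε`. -/
theorem IsMonotoneOp.norm_sub_le (hA : IsMonotoneOp A) (hJ : IsSkewOp J) {ε δ : ℝ}
    {v w : H} (hv : A v + ε • v + J v = 0) (hw : A w + δ • w + J w = 0) :
    ε * ‖v - w‖ ≤ |ε - δ| * ‖w‖ := by
  have h1 := hA v w
  have h2 : A v - A w = -(ε • (v - w)) - (ε - δ) • w - J (v - w) := by
    have e1 : A v = -(ε • v) - J v := by
      rw [← sub_eq_zero, ← hv]; abel
    have e2 : A w = -(δ • w) - J w := by
      rw [← sub_eq_zero, ← hw]; abel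
    rw [e1, e2, map_sub, smul_sub, sub_smul]; abel
  rw [h2, inner_sub_left, inner_sub_left, hJ (v - w), inner_neg_left, real_inner_smul_left,
    real_inner_smul_left, real_inner_self_eq_norm_sq] at h1
  have h3 : -((ε - δ) * inner ℝ w (v - w)) ≤ |ε - δ| * (‖w‖ * ‖v - w‖) := by
    refine (neg_le_abs _).trans ?_
    rw [abs_mul]
    gcongr
    exact abs_real_inner_le_norm _ _
  rcases eq_or_lt_of_le (norm_nonneg (v - w)) with h0 | h0
  · rw [← h0]; simp; positivity
  · refine le_of_mul_le_mul_right ?_ h0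
    nlinarith

/-- A difference quotient paired with w is r⁻² times a monotonicity product, hence nonnegative; let
r → 0. -/
theorem IsMonotoneOp.inner_fderiv_nonneg (hA : IsMonotoneOp A) {A' : H →L[ℝ] H} {v : H}
    (h : HasFDerivAt A A' v) (w : H) : 0 ≤ inner ℝ (A' w) w := by
  have h1 : HasDerivAt (fun r : ℝ => A (v + r • w)) (A' w) 0 := by
    have h2 : HasDerivAt (fun r : ℝ => v + r • w) w 0 := by
      simpa using ((hasDerivAt_id (0 : ℝ)).smul_const w).const_add v
    have h3 : HasFDerivAt A A' (v + (0 : ℝ) • w) := by simpa using h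
    exact h3.comp_hasDerivAt 0 h2
  have h4 := hasDerivAt_iff_tendsto_slope_zero.1 h1
  have h5 : Tendsto (fun r : ℝ => inner ℝ (r⁻¹ • (A (v + (0 + r) • w) - A (v + (0 : ℝ) • w))) w)
      (𝓝[≠] 0) (𝓝 (inner ℝ (A' w) w)) := h4.inner tendsto_const_nhds
  refine ge_of_tendsto h5 (eventually_mem_nhdsWithin.mono fun r hr => ?_)
  have h6 := hA (v + r • w) v
  rw [add_sub_cancel_left, real_inner_smul_right] at h6
  rw [real_inner_smul_left]
  have hr' : r ≠ 0 := hr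
  have : r⁻¹ * inner ℝ (A (v + (0 + r) • w) - A (v + (0 : ℝ) • w)) w
      = (r⁻¹) ^ 2 * (r * inner ℝ (A (v + r • w) - A v) w) := by
    simp only [zero_add, zero_smul, add_zero]
    field_simp
  rw [this]
  positivity

variable [FiniteDimensional ℝ H]

/-- Pairing the linearized operator with w gives at least ε ‖w‖², since J contributes nothing. It is
therefore injective, and invertible by finite dimension. -/
theorem IsMonotoneOp.exists_equiv (hA : IsMonotoneOp A) (hJ : IsSkewOp J) {A' : H →L[ℝ] H} {v : H}
    (h : HasFDerivAt A A' v) {ε : ℝ} (hε : 0 < ε) :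
    ∃ L : H ≃L[ℝ] H, ∀ w, L w = A' w + ε • w + J w := by
  let B : H →L[ℝ] H := A' + ε • ContinuousLinearMap.id ℝ H + J
  have hB : Function.Injective (B : H →ₗ[ℝ] H) := by
    rw [← LinearMap.ker_eq_bot, LinearMap.ker_eq_bot']
    intro w hw
    have h1 : inner ℝ (A' w + ε • w + J w) w = 0 := by
      have : A' w + ε • w + J w = 0 := hw
      rw [this, inner_zero_left]
    rw [inner_add_left, inner_add_left, hJ w, real_inner_smul_left,
      real_inner_self_eq_norm_sq] at h1
    have h2 := hA.inner_fderiv_nonneg h w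
    have h3 : ‖w‖ ^ 2 = 0 := by
      have : 0 ≤ ‖w‖ ^ 2 := by positivity
      nlinarith
    simpa using h3
  exact ⟨(LinearEquiv.ofInjectiveEndo (B : H →ₗ[ℝ] H) hB).toContinuousLinearEquiv, fun w => rfl⟩

/-- The curve of zeros of `A + J + ε(t)` is differentiable. -/
theorem IsMonotoneOp.exists_hasDerivAt (hA : IsMonotoneOp A) (hJ : IsSkewOp J)
    (hd : Differentiable ℝ A) {ε : ℝ → ℝ} {ε' t R : ℝ} {z : ℝ → H} (hεt : 0 < ε t)
    (hε : HasDerivAt ε ε' t) (hz : ∀ᶠ τ in 𝓝 t, A (z τ) + ε τ • z τ + J (z τ) = 0)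
    (hR : ∀ᶠ τ in 𝓝 t, ‖z τ‖ ≤ R) :
    ∃ w, HasDerivAt z w t ∧ ε t * ‖w‖ ≤ |ε'| * R := by
  have hzt := hz.self_of_nhds
  obtain ⟨L, hL⟩ := hA.exists_equiv hJ (hd (z t)).hasFDerivAt hεt
  -- `IsMonotoneOp.norm_sub_le` gives a Lipschitz estimate at t before any differentiability of z is
  -- known.
  have hO : (fun τ => z τ - z t) =O[𝓝 t] fun τ => τ - t := by
    refine IsBigO.trans ?_ hε.isBigO_sub
    refine IsBigO.of_bound (R / ε t) ?_
    filter_upwards [hz, hR] with τ h1 h2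
    have h3 := hA.norm_sub_le hJ hzt h1
    rw [norm_sub_rev, Real.norm_eq_abs, abs_sub_comm, div_mul_eq_mul_div, le_div_iff₀ hεt]
    calc ‖z t - z τ‖ * ε t ≤ |ε t - ε τ| * ‖z τ‖ := by linarith
      _ ≤ |ε t - ε τ| * R := by gcongr
      _ = _ := by ring
  have hcont : ContinuousAt z t := by
    have h1 : Tendsto (fun τ => z τ - z t) (𝓝 t) (𝓝 0) := by
      refine hO.trans_tendsto ?_
      have : ContinuousAt (fun τ : ℝ => τ - t) t := by fun_prop
      simpa [ContinuousAt] using this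
    have h2 := h1.add_const (z t)
    simpa [ContinuousAt] using h2
  have hrem : HasDerivAt (fun τ => A (z τ) - A (z t) - fderiv ℝ A (z t) (z τ - z t)) 0 t := by
    rw [hasDerivAt_iff_isLittleO]
    have h1 := (hasFDerivAt_iff_isLittleO.1 (hd (z t)).hasFDerivAt).comp_tendsto hcont
    have h2 := h1.trans_isBigO hO
    refine h2.congr_left fun τ => ?_
    simp
  have hmul : HasDerivAt (fun τ => (ε τ - ε t) • z τ) (ε' • z t) t := by
    rw [hasDerivAt_iff_tendsto_slope]
    have h1 := (hasDerivAt_iff_tendsto_slope.1 hε).smul (hcont.tendsto.mono_left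
      (nhdsWithin_le_nhds (s := {t}ᶜ)))
    refine h1.congr fun τ => ?_
    simp [slope_def_module, smul_smul]
  -- Subtracting the equations at τ and t leaves L (z τ - z t) = -(ε τ - ε t) • z τ minus the
  -- linearization remainder of A. Both terms have known derivatives at t, so inverting L
  -- differentiates z.
  have hLz : HasDerivAt (fun τ => L (z τ - z t)) (-(ε' • z t) - 0) t := by
    refine (hmul.neg.sub hrem).congr_of_eventuallyEq ?_
    filter_upwards [hz] with τ h1
    have e1 : A (z τ) = -(ε τ • z τ) - J (z τ) := by
      rw [← sub_eq_zero, ← h1]; abel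
    have e2 : A (z t) = -(ε t • z t) - J (z t) := by
      rw [← sub_eq_zero, ← hzt]; abel
    simp only [Pi.neg_apply, Pi.sub_apply]
    rw [hL, e1, e2, map_sub, map_sub, smul_sub, sub_smul]; abel
  have hz' : HasDerivAt z (L.symm (-(ε' • z t) - 0)) t := by
    have h1 := (L.symm.hasFDerivAt.comp_hasDerivAt t hLz).add_const (z t)
    refine h1.congr_of_eventuallyEq (Eventually.of_forall fun τ => ?_)
    simp
  set w := L.symm (-(ε' • z t) - 0) with hw
  refine ⟨w, hz', ?_⟩
  have h1 : fderiv ℝ A (z t) w + ε t • w + J w = -(ε' • z t) := by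
    rw [← hL, hw]; simp
  have h2 := hA.inner_fderiv_nonneg (hd (z t)).hasFDerivAt w
  -- Pair the differentiated equation with w: monotonicity and skewness leave ε ‖w‖² ≤ -ε' ⟪z, w⟫.
  have h3 := congrArg (fun v => inner ℝ v w) h1
  simp only [inner_add_left, hJ w, real_inner_smul_left, inner_neg_left,
    real_inner_self_eq_norm_sq] at h3
  have h4 : -(ε' * inner ℝ (z t) w) ≤ |ε'| * (R * ‖w‖) := by
    refine (neg_le_abs _).trans ?_
    rw [abs_mul]
    gcongr
    exact (abs_real_inner_le_norm _ _).trans (by gcongr; exact hR.self_of_nhds)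
  rcases eq_or_lt_of_le (norm_nonneg w) with h0 | h0
  · rw [← h0, mul_zero]
    exact mul_nonneg (abs_nonneg _) ((norm_nonneg _).trans hR.self_of_nhds)
  · refine le_of_mul_le_mul_right ?_ h0
    nlinarith

/-- The curve of zeros of `A + J + ε(t)` with `ε(t) → 0` tends to the zero of least norm. -/
theorem IsMonotoneOp.exists_tendsto (hA : IsMonotoneOp A) (hJ : IsSkewOp J)
    (hc : Continuous A) (hne : ∃ w, A w + J w = 0) {ε : ℝ → ℝ} {z : ℝ → H}
    (hpos : ∀ᶠ t in atTop, 0 < ε t) (hε : Tendsto ε atTop (𝓝 0))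
    (hz : ∀ᶠ t in atTop, A (z t) + ε t • z t + J (z t) = 0) :
    ∃ v, A v + J v = 0 ∧ (∀ w, A w + J w = 0 → ‖v‖ ^ 2 + ‖w - v‖ ^ 2 ≤ ‖w‖ ^ 2) ∧
      Tendsto z atTop (𝓝 v) := by
  obtain ⟨w₀, hw₀⟩ := hne
  have hineq : ∀ w, A w + J w = 0 → ∀ᶠ t in atTop, inner ℝ (z t) (z t - w) ≤ 0 := by
    intro w hw
    filter_upwards [hpos, hz] with t h1 h2
    exact hA.inner_sub_nonpos hJ h1 h2 hw
  have hmem : ∀ᶠ t in atTop, z t ∈ Metric.closedBall (0 : H) ‖w₀‖ := by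
    filter_upwards [hineq w₀ hw₀] with t h1
    simpa using norm_le_of_inner_sub_nonpos h1
  have hK : IsCompact (Metric.closedBall (0 : H) ‖w₀‖) := isCompact_closedBall _ _
  have hlim : Tendsto (fun t => A (z t) + J (z t)) atTop (𝓝 0) := by
    have h1 : Tendsto (fun t => ‖-(ε t)‖ * ‖w₀‖) atTop (𝓝 0) := by
      simpa using (hε.norm).mul_const ‖w₀‖
    refine squeeze_zero_norm' ?_ h1
    filter_upwards [hz, hmem] with t h2 h3
    have : A (z t) + J (z t) = (-(ε t)) • z t := by
      rw [← sub_eq_zero, ← h2, neg_smul]; abel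
    rw [this, norm_smul]
    gcongr
    simpa using h3
  -- Every cluster point is a zero of minimal norm. The quadratic surplus makes such a point unique,
  -- so compactness forces the whole curve to converge.
  have hcl : ∀ v, MapClusterPt v atTop z → A v + J v = 0 ∧
      ∀ w, A w + J w = 0 → ‖v‖ ^ 2 + ‖w - v‖ ^ 2 ≤ ‖w‖ ^ 2 := by
    intro v hv
    constructor
    · have h1 : MapClusterPt (A v + J v) atTop ((fun y => A y + J y) ∘ z) :=
        hv.continuousAt_comp (f := fun y => A y + J y) (hc.add J.continuous).continuousAt
      have h2 : ClusterPt (A v + J v) (𝓝 (0 : H)) := ClusterPt.mono h1 hlim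
      exact eq_of_nhds_neBot h2
    · intro w hw
      refine norm_sq_add_le_of_inner_sub_nonpos ?_
      have hcl : IsClosed {y : H | inner ℝ y (y - w) ≤ 0} :=
        isClosed_le (by fun_prop) continuous_const
      exact hcl.mem_of_mapClusterPt hv (hineq w hw)
  obtain ⟨v, -, hv⟩ := hK.exists_mapClusterPt_of_frequently hmem.frequently
  obtain ⟨h1, h2⟩ := hcl v hv
  refine ⟨v, h1, h2, hK.tendsto_nhds_of_unique_mapClusterPt hmem fun v' _ hv' => ?_⟩
  obtain ⟨h3, h4⟩ := hcl v' hv'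
  have h5 := h2 v' h3
  have h6 := h4 v h1
  have h7 : ‖v' - v‖ ^ 2 ≤ 0 := by
    rw [norm_sub_rev v v'] at h6; linarith
  have h8 : ‖v' - v‖ = 0 := by nlinarith [norm_nonneg (v' - v)]
  exact sub_eq_zero.1 (norm_eq_zero.1 h8)

end Tikhonov

/-! ### The primal-dual gap and the algebra of the energy. -/

section Energy

variable {H : Type*} [NormedAddCommGroup H] [InnerProductSpace ℝ H]

/-- The primal-dual gap `Φ(v₁, w₂) - Φ(w₁, v₂)` of a regularized convex-concave function with
bilinear coupling, in operator form. -/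
def opGap (φ : H → ℝ) (J : H →L[ℝ] H) (ε : ℝ) (v w : H) : ℝ :=
  φ v - φ w + ε / 2 * (‖v‖ ^ 2 - ‖w‖ ^ 2) + inner ℝ (J w) v

/-- `A` is a subgradient selection of `φ`. -/
def IsSubgrad (φ : H → ℝ) (A : H → H) : Prop := ∀ v w, φ v + inner ℝ (A v) (w - v) ≤ φ w

variable {φ : H → ℝ} {A : H → H} {J : H →L[ℝ] H}

theorem IsSubgrad.isMonotoneOp (h : IsSubgrad φ A) : IsMonotoneOp A := by
  intro v w
  have h1 := h v w
  have h2 := h w v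
  rw [inner_sub_left]
  rw [← neg_sub v w, inner_neg_right] at h1
  linarith

/-- Convexity based at w, where the equation replaces A w; the regularization supplies the quadratic
growth. -/
theorem IsSubgrad.le_opGap (h : IsSubgrad φ A) (hJ : IsSkewOp J) {ε : ℝ} {v w : H}
    (hw : A w + ε • w + J w = 0) : ε / 2 * ‖v - w‖ ^ 2 ≤ opGap φ J ε v w := by
  have h1 := h w v
  have e1 : A w = -(ε • w) - J w := by
    rw [← sub_eq_zero, ← hw]; abel
  rw [e1] at h1
  simp only [inner_sub_left, inner_sub_right, inner_neg_left, real_inner_smul_left,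
    real_inner_self_eq_norm_sq, hJ w] at h1
  rw [norm_sub_sq_real, real_inner_comm, opGap]
  linarith

/-- Convexity based at v. It converts the pairing that appears in E' into decay of both the gap and
‖z - ζ‖². -/
theorem IsSubgrad.opGap_add_le (h : IsSubgrad φ A) (hJ : IsSkewOp J) (ε : ℝ) (v w : H) :
    opGap φ J ε v w + ε / 2 * ‖v - w‖ ^ 2 ≤ inner ℝ (A v + ε • v + J w) (v - w) := by
  have h1 := h v w
  rw [← neg_sub v w, inner_neg_right] at h1
  rw [norm_sub_sq_real, opGap, inner_add_left, inner_add_left]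
  simp only [inner_sub_right, real_inner_smul_left,
    real_inner_self_eq_norm_sq, hJ w] at h1 ⊢
  linarith

/-- The equation for ζ eliminates A (ζ t), so that ζ' survives only through J ζ'. -/
theorem hasDerivAt_opGap (hφ : ∀ v, HasFDerivAt φ (innerSL ℝ (A v)) v) (hJ : IsSkewOp J)
    {ε : ℝ → ℝ} {z ζ : ℝ → H} {ε' t : ℝ} {z' ζ' : H} (hε : HasDerivAt ε ε' t)
    (hz : HasDerivAt z z' t) (hζ : HasDerivAt ζ ζ' t)
    (h : A (ζ t) + ε t • ζ t + J (ζ t) = 0) :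
    HasDerivAt (fun τ => opGap φ J (ε τ) (z τ) (ζ τ))
      (inner ℝ (A (z t) + ε t • z t + J (ζ t)) z'
        + (ε' / 2 * (‖z t‖ ^ 2 - ‖ζ t‖ ^ 2) + inner ℝ (J ζ') (z t - ζ t))) t := by
  have h1 := (hφ (z t)).comp_hasDerivAt t hz
  have h2 := (hφ (ζ t)).comp_hasDerivAt t hζ
  have h3 := (J.hasFDerivAt.comp_hasDerivAt t hζ).inner ℝ hz
  have h4 := (h1.sub h2).add (((hε.div_const 2).mul (hz.norm_sq.sub hζ.norm_sq)).add h3)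
  have e1 : A (ζ t) = -(ε t • ζ t) - J (ζ t) := by
    rw [← sub_eq_zero, ← h]; abel
  have h5 := hJ.inner_comm (ζ t) ζ'
  have h6 : HasDerivAt (fun τ => opGap φ J (ε τ) (z τ) (ζ τ)) _ t :=
    h4.congr_of_eventuallyEq (Eventually.of_forall fun τ => by simp [opGap]; ring)
  refine h6.congr_deriv ?_
  simp only [innerSL_apply_apply, e1, inner_add_left, inner_sub_left, inner_neg_left,
    real_inner_smul_left, inner_sub_right, h5, Pi.sub_apply, Function.comp_apply]
  ring

/-- The cross terms in the derivative of the energy cancel. -/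
theorem energy_rate_identity (hJ : IsSkewOp J) {a γ P Q β σ θ : ℝ} {u v Γ g w : H}
    (hΓ : Γ = g + J u + θ • J v) (hσ : σ = P * β + γ * P * (1 - Q)) (hθ : a * β * θ = σ) :
    σ * inner ℝ g v
      + inner ℝ (a • u + P • (v + γ • Γ)) ((Q - 1) • v - a • w - β • Γ)
      + a * (1 - Q) * inner ℝ u (v - w)
    = -a * inner ℝ (a • u + P • (v + γ • Γ)) w - a * β * inner ℝ g u
      - P * (1 - Q) * ‖v‖ ^ 2 - γ * P * β * ‖Γ‖ ^ 2 - a * (1 - Q) * inner ℝ u w := by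
  have h1 : inner ℝ Γ v = inner ℝ g v + inner ℝ (J u) v := by
    rw [hΓ, inner_add_left, inner_add_left, real_inner_smul_left, hJ v]; ring
  have h2 : inner ℝ Γ u = inner ℝ g u - θ * inner ℝ (J u) v := by
    rw [hΓ, inner_add_left, inner_add_left, real_inner_smul_left, hJ u, hJ.inner_comm v u]; ring
  have h3 : inner ℝ u Γ = inner ℝ Γ u := real_inner_comm _ _
  have h4 : inner ℝ v Γ = inner ℝ Γ v := real_inner_comm _ _
  simp only [inner_add_left, inner_sub_right, real_inner_smul_left, real_inner_smul_right,
    real_inner_self_eq_norm_sq, h3, h4, h1, h2]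
  -- The ⟪u, v⟫ terms cancel outright. The other terms to remove are multiples of ⟪g, v⟫ and ⟪J u,
  -- v⟫, and `hσ` with `hθ` makes both coefficients vanish.
  linear_combination (inner ℝ (J u) v) * hθ + (inner ℝ g v + inner ℝ (J u) v) * hσ

end Energy

/-! ### Dissipation against forcing. -/

section Estimates

variable {H : Type*} [NormedAddCommGroup H] [InnerProductSpace ℝ H] {J : H →L[ℝ] H}

/-- Since ε decreases, only an upper bound of ‖ζ‖² - ‖z‖² matters; it is linear in ‖z - ζ‖ because
the quadratic remainder has the favourable sign. -/
theorem energy_forcing_le {c p R t : ℝ} (hc : 0 < c) (hp : 0 < p) (hR : 0 ≤ R) (ht : 1 ≤ t)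
    {z ζ w : H} (hζ : ‖ζ‖ ≤ R) (hw : ‖w‖ ≤ p * R / t) :
    -(p * c * t ^ (-p - 1)) / 2 * (‖z‖ ^ 2 - ‖ζ‖ ^ 2) + inner ℝ (J w) (z - ζ)
      ≤ p * R * (c + ‖J‖) * t ^ (-1 : ℝ) * ‖z - ζ‖ := by
  have ht0 : 0 < t := by linarith
  have h1 : ‖ζ‖ ^ 2 - ‖z‖ ^ 2 ≤ 2 * R * ‖z - ζ‖ := by
    have e : z = (z - ζ) + ζ := by abel
    have h2 : ‖z‖ ^ 2 = ‖z - ζ‖ ^ 2 + 2 * inner ℝ (z - ζ) ζ + ‖ζ‖ ^ 2 := by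
      conv_lhs => rw [e]
      exact norm_add_sq_real _ _
    have h3 := (abs_le.1 (abs_real_inner_le_norm (z - ζ) ζ)).1
    have h4 : ‖z - ζ‖ * ‖ζ‖ ≤ ‖z - ζ‖ * R := by gcongr
    nlinarith [sq_nonneg ‖z - ζ‖]
  have h2 : inner ℝ (J w) (z - ζ) ≤ ‖J‖ * (p * R / t) * ‖z - ζ‖ := by
    refine (real_inner_le_norm _ _).trans ?_
    gcongr
    exact (J.le_opNorm w).trans (by gcongr)
  have h3 : t ^ (-p - 1) ≤ t ^ (-1 : ℝ) := Real.rpow_le_rpow_of_exponent_le ht (by linarith)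
  have h4 : 0 < t ^ (-p - 1) := Real.rpow_pos_of_pos ht0 _
  have h5 : p * c * t ^ (-p - 1) / 2 * (‖ζ‖ ^ 2 - ‖z‖ ^ 2)
      ≤ p * c * t ^ (-1 : ℝ) / 2 * (2 * R * ‖z - ζ‖) := by
    calc _ ≤ p * c * t ^ (-p - 1) / 2 * (2 * R * ‖z - ζ‖) := by gcongr
      _ ≤ _ := by gcongr
  rw [Real.rpow_neg_one] at h5 ⊢
  rw [div_eq_mul_inv (p * R)] at h2
  nlinarith

/-- The drift of ε and ζ contributes terms linear in ‖z - ζ‖, ‖v‖ and ‖Γ‖. Young's inequality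
charges each to part of the dissipation, and the final constant is the sum of the three resulting k²
/ (4δ). -/
theorem energy_rate_le {a γ c p q s R t β σ σ' Q μ D : ℝ} (ha : 0 < a) (hγ : 0 < γ)
    (hc : 0 < c) (hp : 0 < p) (hq : 0 < q) (hs : 0 < s) (hR : 0 ≤ R) (ht : 1 ≤ t)
    (hβ : t ^ (q + s) / 2 ≤ β) (hσ₀ : 0 ≤ σ) (hσ : σ ≤ 2 * t ^ (2 * q + s))
    (hσ' : σ' ≤ a / 4 * t ^ (q + s)) (hQ₀ : 0 ≤ Q) (hQ : Q ≤ 1 / 2)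
    (hμ : μ ≤ a * c / 16 * t ^ (q + s - p)) {z ζ v Γ g w : H}
    (hζ : ‖ζ‖ ≤ R) (hw : ‖w‖ ≤ p * R / t) (hD₀ : 0 ≤ D)
    (hD : D + c / t ^ p / 2 * ‖z - ζ‖ ^ 2 ≤ inner ℝ g (z - ζ)) :
    σ' * D + σ * (-(p * c * t ^ (-p - 1)) / 2 * (‖z‖ ^ 2 - ‖ζ‖ ^ 2) + inner ℝ (J w) (z - ζ))
      + μ * ‖z - ζ‖ ^ 2
      + (-a * inner ℝ (a • (z - ζ) + t ^ q • (v + γ • Γ)) w - a * β * inner ℝ g (z - ζ)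
      - t ^ q * (1 - Q) * ‖v‖ ^ 2 - γ * t ^ q * β * ‖Γ‖ ^ 2
      - a * (1 - Q) * inner ℝ (z - ζ) w)
    ≤ -(a / 4 * t ^ (q + s) * D + a * c / 8 * t ^ (q + s - p) * ‖z - ζ‖ ^ 2
        + 1 / 4 * t ^ q * ‖v‖ ^ 2 + γ / 4 * t ^ (2 * q + s) * ‖Γ‖ ^ 2)
      + ((2 * (p * R * (c + ‖J‖)) + a * (p * R) * a + a * (p * R)) ^ 2 / (4 * (a * c / 16))
          + (a * (p * R)) ^ 2 / (4 * (1 / 4)) + (a * (p * R) * γ) ^ 2 / (4 * (γ / 4)))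
        * t ^ (3 * q + s + p - 2) := by
  have ht0 : 0 < t := by linarith
  have hforce := energy_forcing_le (J := J) (z := z) hc hp hR ht hζ hw
  set U := ‖z - ζ‖ with hU
  set k₀ := p * R * (c + ‖J‖) with hk₀
  have hk₀' : 0 ≤ k₀ := by positivity
  have hU0 : 0 ≤ U := norm_nonneg _
  have hP := Real.rpow_pos_of_pos ht0 q
  -- Enlarging t ^ (-1) gives all terms linear in U one exponent, so a single use of Young handles
  -- them.
  have hmid : t ^ (-1 : ℝ) ≤ t ^ (2 * q + s - 1) :=
    Real.rpow_le_rpow_of_exponent_le ht (by linarith)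
  have e1 : t ^ (2 * q + s) * t ^ (-1 : ℝ) = t ^ (2 * q + s - 1) := by
    rw [← Real.rpow_add ht0]; congr 1
  have e2 : t ^ q * t ^ (-1 : ℝ) = t ^ (q - 1) := by
    rw [← Real.rpow_add ht0]; congr 1
  have e3 : t ^ q * t ^ (q + s) = t ^ (2 * q + s) := by
    rw [← Real.rpow_add ht0]; congr 1; ring
  have e4 : t ^ (q + s) * (c / t ^ p) = c * t ^ (q + s - p) := by
    rw [Real.rpow_sub ht0]; ring
  have hw' : ‖w‖ ≤ p * R * t ^ (-1 : ℝ) := by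
    rwa [Real.rpow_neg_one, ← div_eq_mul_inv]
  have b1 : σ * (-(p * c * t ^ (-p - 1)) / 2 * (‖z‖ ^ 2 - ‖ζ‖ ^ 2) + inner ℝ (J w) (z - ζ))
      ≤ 2 * k₀ * t ^ (2 * q + s - 1) * U := by
    calc _ ≤ σ * (k₀ * t ^ (-1 : ℝ) * U) := by gcongr
      _ ≤ 2 * t ^ (2 * q + s) * (k₀ * t ^ (-1 : ℝ) * U) := by gcongr
      _ = 2 * k₀ * t ^ (2 * q + s - 1) * U := by rw [← e1]; ring
  have b2 : -a * inner ℝ (a • (z - ζ) + t ^ q • (v + γ • Γ)) w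
      ≤ a * (p * R) * a * t ^ (2 * q + s - 1) * U + a * (p * R) * t ^ (q - 1) * ‖v‖
        + a * (p * R) * γ * t ^ (q - 1) * ‖Γ‖ := by
    have h1 : ‖a • (z - ζ) + t ^ q • (v + γ • Γ)‖ ≤ a * U + t ^ q * (‖v‖ + γ * ‖Γ‖) := by
      refine (norm_add_le _ _).trans ?_
      rw [norm_smul, norm_smul, Real.norm_of_nonneg ha.le, Real.norm_of_nonneg hP.le]
      gcongr
      refine (norm_add_le _ _).trans ?_
      rw [norm_smul, Real.norm_of_nonneg hγ.le]
    calc _ = a * -inner ℝ (a • (z - ζ) + t ^ q • (v + γ • Γ)) w := by ring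
      _ ≤ a * ((a * U + t ^ q * (‖v‖ + γ * ‖Γ‖)) * (p * R * t ^ (-1 : ℝ))) := by
        gcongr
        refine (neg_le_abs _).trans ((abs_real_inner_le_norm _ _).trans ?_)
        gcongr
      _ = a * (p * R) * a * t ^ (-1 : ℝ) * U + a * (p * R) * t ^ (q - 1) * ‖v‖
        + a * (p * R) * γ * t ^ (q - 1) * ‖Γ‖ := by rw [← e2]; ring
      _ ≤ _ := by gcongr
  have b3 : -(a * (1 - Q) * inner ℝ (z - ζ) w) ≤ a * (p * R) * t ^ (2 * q + s - 1) * U := by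
    have hQ1 : 0 ≤ 1 - Q := by linarith
    calc _ = a * (1 - Q) * -inner ℝ (z - ζ) w := by ring
      _ ≤ a * 1 * (U * (p * R * t ^ (2 * q + s - 1))) := by
        have : -inner ℝ (z - ζ) w ≤ U * (p * R * t ^ (2 * q + s - 1)) := by
          refine (neg_le_abs _).trans ((abs_real_inner_le_norm _ _).trans ?_)
          rw [← hU]
          gcongr
          exact hw'.trans (by gcongr)
        calc _ ≤ a * (1 - Q) * (U * (p * R * t ^ (2 * q + s - 1))) := by gcongr
          _ ≤ _ := by gcongr; linarith
      _ = _ := by ring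
  have b4 : -(a * β * inner ℝ g (z - ζ))
      ≤ -(a / 2 * t ^ (q + s) * D + a * c / 4 * t ^ (q + s - p) * U ^ 2) := by
    have h1 : t ^ (q + s) / 2 * (D + c / t ^ p / 2 * U ^ 2) ≤ β * inner ℝ g (z - ζ) := by
      have : 0 ≤ D + c / t ^ p / 2 * U ^ 2 := by positivity
      have hβ0 : 0 ≤ β := le_trans (by positivity) hβ
      gcongr
    have h2 := mul_le_mul_of_nonneg_left h1 ha.le
    have h3 : a * (t ^ (q + s) / 2 * (D + c / t ^ p / 2 * U ^ 2))
        = a / 2 * t ^ (q + s) * D + a / 4 * (t ^ (q + s) * (c / t ^ p)) * U ^ 2 := by ring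
    rw [h3, e4] at h2
    linarith
  have b5 : -(t ^ q * (1 - Q) * ‖v‖ ^ 2) ≤ -(1 / 2 * t ^ q * ‖v‖ ^ 2) := by
    have : t ^ q * (1 / 2) * ‖v‖ ^ 2 ≤ t ^ q * (1 - Q) * ‖v‖ ^ 2 := by gcongr; linarith
    linarith
  have b6 : -(γ * t ^ q * β * ‖Γ‖ ^ 2) ≤ -(γ / 2 * t ^ (2 * q + s) * ‖Γ‖ ^ 2) := by
    have h1 : γ * t ^ q * (t ^ (q + s) / 2) * ‖Γ‖ ^ 2 ≤ γ * t ^ q * β * ‖Γ‖ ^ 2 := by gcongr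
    have h2 : γ * t ^ q * (t ^ (q + s) / 2) * ‖Γ‖ ^ 2
        = γ / 2 * (t ^ q * t ^ (q + s)) * ‖Γ‖ ^ 2 := by ring
    rw [h2, e3] at h1
    linarith
  have b7 : σ' * D ≤ a / 4 * t ^ (q + s) * D := by gcongr
  have b8 : μ * U ^ 2 ≤ a * c / 16 * t ^ (q + s - p) * U ^ 2 := by gcongr
  have y1 := rpow_mul_le_young ht0 (δ := a * c / 16) (by positivity)
    (2 * k₀ + a * (p * R) * a + a * (p * R)) (2 * q + s - 1) (q + s - p) U
  have y2 := rpow_mul_le_young ht0 (δ := 1 / 4) (by positivity) (a * (p * R)) (q - 1) q ‖v‖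
  have y3 := rpow_mul_le_young ht0 (δ := γ / 4) (by positivity) (a * (p * R) * γ) (q - 1)
    (2 * q + s) ‖Γ‖
  -- The slowest of the three residual powers; it sets the rate.
  rw [show 2 * (2 * q + s - 1) - (q + s - p) = 3 * q + s + p - 2 by ring] at y1
  have m2 : t ^ (2 * (q - 1) - q) ≤ t ^ (3 * q + s + p - 2) :=
    Real.rpow_le_rpow_of_exponent_le ht (by linarith)
  have m3 : t ^ (2 * (q - 1) - (2 * q + s)) ≤ t ^ (3 * q + s + p - 2) :=
    Real.rpow_le_rpow_of_exponent_le ht (by linarith)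
  have n2 := mul_le_mul_of_nonneg_left m2
    (by positivity : 0 ≤ (a * (p * R)) ^ 2 / (4 * (1 / 4)))
  have n3 := mul_le_mul_of_nonneg_left m3
    (by positivity : 0 ≤ (a * (p * R) * γ) ^ 2 / (4 * (γ / 4)))
  linarith

/-- The four entries of the minimum serve, in order, the gap, ‖u‖², ‖v‖² and ‖Γ‖². -/
theorem energy_le {a γ c p q s t σ Q D : ℝ} (ha : 0 < a) (hγ : 0 < γ)
    (hc : 0 < c) (hs : 0 < s) (hq : 0 < q) (hpq : p - 2 * q - s < 0) (ht : 1 ≤ t)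
    (hσ : σ ≤ 2 * t ^ (2 * q + s)) (hQ₀ : 0 ≤ Q) {u v Γ : H} (hD₀ : 0 ≤ D) :
    min (min (a / 8) (c / (4 * (3 * a + 1)))) (min (1 / 6) (1 / (6 * γ))) * t ^ (-q)
      * (σ * D + 1 / 2 * ‖a • u + t ^ q • (v + γ • Γ)‖ ^ 2 + a / 2 * (1 - Q) * ‖u‖ ^ 2)
    ≤ a / 4 * t ^ (q + s) * D + a * c / 8 * t ^ (q + s - p) * ‖u‖ ^ 2
        + 1 / 4 * t ^ q * ‖v‖ ^ 2 + γ / 4 * t ^ (2 * q + s) * ‖Γ‖ ^ 2 := by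
  have ht0 : 0 < t := by linarith
  set κ := min (min (a / 8) (c / (4 * (3 * a + 1)))) (min (1 / 6) (1 / (6 * γ))) with hκ
  have hκ0 : 0 < κ := by positivity
  have k1 : κ ≤ a / 8 := (min_le_left _ _).trans (min_le_left _ _)
  have k2 : κ * (4 * (3 * a + 1)) ≤ c :=
    (le_div_iff₀ (by positivity)).1 ((min_le_left _ _).trans (min_le_right _ _))
  have k3 : κ ≤ 1 / 6 := (min_le_right _ _).trans (min_le_left _ _)
  have k4 : κ * (6 * γ) ≤ 1 :=
    (le_div_iff₀ (by positivity)).1 ((min_le_right _ _).trans (min_le_right _ _))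
  have hP := Real.rpow_pos_of_pos ht0 q
  have hn : ‖a • u + t ^ q • (v + γ • Γ)‖ ^ 2
      ≤ 3 * (a ^ 2 * ‖u‖ ^ 2 + (t ^ q) ^ 2 * ‖v‖ ^ 2 + (t ^ q) ^ 2 * γ ^ 2 * ‖Γ‖ ^ 2) := by
    have h1 : ‖a • u + t ^ q • (v + γ • Γ)‖ ≤ a * ‖u‖ + t ^ q * (‖v‖ + γ * ‖Γ‖) := by
      refine (norm_add_le _ _).trans ?_
      rw [norm_smul, norm_smul, Real.norm_of_nonneg ha.le, Real.norm_of_nonneg hP.le]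
      gcongr
      refine (norm_add_le _ _).trans ?_
      rw [norm_smul, Real.norm_of_nonneg hγ.le]
    refine (pow_le_pow_left₀ (norm_nonneg _) h1 2).trans ?_
    nlinarith [sq_nonneg (a * ‖u‖ - t ^ q * ‖v‖), sq_nonneg (a * ‖u‖ - t ^ q * γ * ‖Γ‖),
      sq_nonneg (t ^ q * ‖v‖ - t ^ q * γ * ‖Γ‖)]
  have e1 : t ^ (-q) * t ^ (2 * q + s) = t ^ (q + s) := by
    rw [← Real.rpow_add ht0]; congr 1; ring
  have e2 : t ^ (-q) * (t ^ q) ^ 2 = t ^ q := by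
    rw [Real.rpow_neg ht0.le]; field_simp
  -- Here p - 2q - s < 0 enters: the dissipation due to regularization must control t ^ (-q) ‖u‖².
  have m1 : t ^ (-q) ≤ t ^ (q + s - p) := Real.rpow_le_rpow_of_exponent_le ht (by linarith)
  have m2 : t ^ q ≤ t ^ (2 * q + s) := Real.rpow_le_rpow_of_exponent_le ht (by linarith)
  have hQ1 : a / 2 * (1 - Q) * ‖u‖ ^ 2 ≤ a / 2 * 1 * ‖u‖ ^ 2 := by gcongr; linarith
  have hσD : σ * D ≤ 2 * t ^ (2 * q + s) * D := by gcongr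
  calc _ ≤ κ * t ^ (-q) * (2 * t ^ (2 * q + s) * D + 1 / 2 * (3 * (a ^ 2 * ‖u‖ ^ 2
          + (t ^ q) ^ 2 * ‖v‖ ^ 2 + (t ^ q) ^ 2 * γ ^ 2 * ‖Γ‖ ^ 2)) + a / 2 * 1 * ‖u‖ ^ 2) := by
        gcongr
    _ = κ * 2 * (t ^ (-q) * t ^ (2 * q + s)) * D
        + κ * (4 * (3 * a + 1)) * (a / 8) * t ^ (-q) * ‖u‖ ^ 2
        + κ * (3 / 2) * (t ^ (-q) * (t ^ q) ^ 2) * ‖v‖ ^ 2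
        + κ * (6 * γ) * (γ / 4) * (t ^ (-q) * (t ^ q) ^ 2) * ‖Γ‖ ^ 2 := by ring
    _ = κ * 2 * t ^ (q + s) * D
        + κ * (4 * (3 * a + 1)) * (a / 8) * t ^ (-q) * ‖u‖ ^ 2
        + κ * (3 / 2) * t ^ q * ‖v‖ ^ 2
        + κ * (6 * γ) * (γ / 4) * t ^ q * ‖Γ‖ ^ 2 := by rw [e1, e2]
    _ ≤ a / 8 * 2 * t ^ (q + s) * D + c * (a / 8) * t ^ (q + s - p) * ‖u‖ ^ 2
        + 1 / 6 * (3 / 2) * t ^ q * ‖v‖ ^ 2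
        + 1 * (γ / 4) * t ^ (2 * q + s) * ‖Γ‖ ^ 2 := by gcongr
    _ = _ := by ring

end Estimates

/-! ### Decay of the energy along a trajectory. -/

section Decay

variable {H : Type*} [NormedAddCommGroup H] [InnerProductSpace ℝ H] {J : H →L[ℝ] H}

theorem hasDerivAt_const_div_rpow (c p : ℝ) {t : ℝ} (ht : 0 < t) :
    HasDerivAt (fun τ : ℝ => c / τ ^ p) (-(p * c * t ^ (-p - 1))) t := by
  have h := (Real.hasDerivAt_rpow_const (x := t) (p := -p) (Or.inl ht.ne')).const_mul c
  refine (h.congr_of_eventuallyEq ?_).congr_deriv (by ring)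
  filter_upwards [eventually_gt_nhds ht] with τ hτ
  rw [Real.rpow_neg hτ.le, div_eq_mul_inv]

/-- The coefficient of the primal-dual gap in the energy; the numerator of `extrap`. -/
def gapCoeff (γ q s t : ℝ) : ℝ := t ^ (2 * q + s) - 2 * γ * q * t ^ (2 * q - 1) + γ * t ^ q

theorem hasDerivAt_gapCoeff (γ q s : ℝ) {t : ℝ} (ht : 0 < t) :
    HasDerivAt (gapCoeff γ q s) ((2 * q + s) * t ^ (2 * q + s - 1)
      - 2 * γ * q * ((2 * q - 1) * t ^ (2 * q - 1 - 1)) + γ * (q * t ^ (q - 1))) t :=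
  ((Real.hasDerivAt_rpow_const (Or.inl ht.ne')).sub
    ((Real.hasDerivAt_rpow_const (Or.inl ht.ne')).const_mul _)).add
    ((Real.hasDerivAt_rpow_const (Or.inl ht.ne')).const_mul _)

theorem eventually_gapCoeff {γ q s : ℝ} (hγ : 0 < γ) (hq : 0 < q) (hs : 0 < s) :
    ∀ᶠ t in atTop, t ^ (2 * q + s) / 2 ≤ gapCoeff γ q s t ∧
      gapCoeff γ q s t ≤ 2 * t ^ (2 * q + s) := by
  filter_upwards [eventually_mul_rpow_le_rpow (a := 2 * q - 1) (b := 2 * q + s) (by linarith)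
    (4 * γ * q), eventually_mul_rpow_le_rpow (a := q) (b := 2 * q + s) (by linarith) γ,
    eventually_gt_atTop 0] with t h1 h2 ht
  have h3 : 0 < t ^ q := Real.rpow_pos_of_pos ht _
  have h4 : 0 < t ^ (2 * q - 1) := Real.rpow_pos_of_pos ht _
  have h5 : 0 < γ * t ^ q := by positivity
  have h6 : 0 < γ * q * t ^ (2 * q - 1) := by positivity
  unfold gapCoeff
  constructor <;> linarith

theorem eventually_deriv_gapCoeff_le {γ q s a : ℝ} (ha : 0 < a) (hq : 0 < q) (hs : 0 < s)
    (hq₁ : q < 1) :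
    ∀ᶠ t in atTop, (2 * q + s) * t ^ (2 * q + s - 1)
      - 2 * γ * q * ((2 * q - 1) * t ^ (2 * q - 1 - 1)) + γ * (q * t ^ (q - 1))
      ≤ a / 4 * t ^ (q + s) := by
  filter_upwards [eventually_mul_rpow_le_rpow (a := 2 * q + s - 1) (b := q + s) (by linarith)
      (12 / a * (2 * q + s)),
    eventually_mul_rpow_le_rpow (a := 2 * q - 1 - 1) (b := q + s) (by linarith)
      (12 / a * (-(2 * γ * q) * (2 * q - 1))),
    eventually_mul_rpow_le_rpow (a := q - 1) (b := q + s) (by linarith)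
      (12 / a * (γ * q))] with t h1 h2 h3
  have h4 := mul_le_mul_of_nonneg_left (add_le_add (add_le_add h1 h2) h3)
    (by positivity : 0 ≤ a / 12)
  have e : a / 12 * (12 / a * (2 * q + s) * t ^ (2 * q + s - 1)
      + 12 / a * (-(2 * γ * q) * (2 * q - 1)) * t ^ (2 * q - 1 - 1)
      + 12 / a * (γ * q) * t ^ (q - 1)) = (2 * q + s) * t ^ (2 * q + s - 1)
      - 2 * γ * q * ((2 * q - 1) * t ^ (2 * q - 1 - 1)) + γ * (q * t ^ (q - 1)) := by
    field_simp
    ring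
  rw [e] at h4
  linarith

theorem eventually_extrapDenom {γ q s : ℝ} (hs : 0 < s) :
    ∀ᶠ t in atTop, t ^ (q + s) / 2 ≤ t ^ (q + s) - γ * q * t ^ (q - 1) := by
  filter_upwards [eventually_mul_rpow_le_rpow (a := q - 1) (b := q + s) (by linarith)
    (2 * γ * q)] with t h1
  linarith

/-- Decay of the gap and of the distance to the curve of regularized saddle points. -/
theorem eventually_opGap_le {φ : H → ℝ} {A : H → H}
    (hφ : ∀ v, HasFDerivAt φ (innerSL ℝ (A v)) v) (hA : IsSubgrad φ A) (hJ : IsSkewOp J)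
    {α γ q s c p R : ℝ} (hα : 1 < α) (hγ : 0 < γ) (hq₀ : 0 < q) (hq₁ : q < 1) (hs : 0 < s)
    (hc : 0 < c) (hp₀ : 0 < p) (hp₁ : p < 1) (hpq : p - 2 * q - s < 0) (hR : 0 ≤ R)
    {z v v' Γ Γ' ζ w : ℝ → H} (hz : ∀ᶠ t in atTop, HasDerivAt z (v t) t)
    (hv : ∀ᶠ t in atTop, HasDerivAt v (v' t) t) (hΓ : ∀ᶠ t in atTop, HasDerivAt Γ (Γ' t) t)
    (hode : ∀ᶠ t in atTop, v' t + (α / t ^ q) • v t + γ • Γ' t + t ^ s • Γ t = 0)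
    (hΓeq : ∀ᶠ t in atTop,
      Γ t = A (z t) + (c / t ^ p) • z t + J (z t + extrap α γ q s t • v t))
    (hζ : ∀ᶠ t in atTop, HasDerivAt ζ (w t) t) (hw : ∀ᶠ t in atTop, ‖w t‖ ≤ p * R / t)
    (hζR : ∀ᶠ t in atTop, ‖ζ t‖ ≤ R)
    (hζeq : ∀ᶠ t in atTop, A (ζ t) + (c / t ^ p) • ζ t + J (ζ t) = 0) :
    ∃ M, 0 < M ∧ ∀ᶠ t in atTop,
      opGap φ J (c / t ^ p) (z t) (ζ t) ≤ M * t ^ (2 * q + p - 2) ∧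
      ‖z t - ζ t‖ ^ 2 ≤ M * t ^ (4 * q + s + p - 2) := by
  set a := α - 1 with ha_def
  have ha : 0 < a := by linarith
  let E : ℝ → ℝ := fun t => gapCoeff γ q s t * opGap φ J (c / t ^ p) (z t) (ζ t)
    + 1 / 2 * ‖a • (z t - ζ t) + t ^ q • (v t + γ • Γ t)‖ ^ 2
    + a / 2 * (1 - q * t ^ (q - 1)) * ‖z t - ζ t‖ ^ 2
  let σ' : ℝ → ℝ := fun t => (2 * q + s) * t ^ (2 * q + s - 1)
      - 2 * γ * q * ((2 * q - 1) * t ^ (2 * q - 1 - 1)) + γ * (q * t ^ (q - 1))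
  let E' : ℝ → ℝ := fun t => σ' t * opGap φ J (c / t ^ p) (z t) (ζ t)
      + gapCoeff γ q s t * (-(p * c * t ^ (-p - 1)) / 2 * (‖z t‖ ^ 2 - ‖ζ t‖ ^ 2)
        + inner ℝ (J (w t)) (z t - ζ t))
      + a / 2 * (q * (1 - q) * t ^ (q - 2)) * ‖z t - ζ t‖ ^ 2
      + (-a * inner ℝ (a • (z t - ζ t) + t ^ q • (v t + γ • Γ t)) (w t)
        - a * (t ^ (q + s) - γ * q * t ^ (q - 1))
          * inner ℝ (A (z t) + (c / t ^ p) • z t + J (ζ t)) (z t - ζ t)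
        - t ^ q * (1 - q * t ^ (q - 1)) * ‖v t‖ ^ 2
        - γ * t ^ q * (t ^ (q + s) - γ * q * t ^ (q - 1)) * ‖Γ t‖ ^ 2
        - a * (1 - q * t ^ (q - 1)) * inner ℝ (z t - ζ t) (w t))
  have hden := eventually_extrapDenom (γ := γ) (q := q) hs
  have hE : ∀ᶠ t in atTop, HasDerivAt E (E' t) t := by
    filter_upwards [hz, hv, hΓ, hode, hΓeq, hζ, hζeq, hden, eventually_gt_atTop 0]
      with t hz hv hΓ hode hΓeq hζ hζeq hden ht
    have hPpos := Real.rpow_pos_of_pos ht q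
    have d1 := hasDerivAt_opGap hφ hJ (hasDerivAt_const_div_rpow c p ht) hz hζ hζeq
    have d2 := (hasDerivAt_gapCoeff γ q s ht).mul d1
    have dP : HasDerivAt (fun τ : ℝ => τ ^ q) (q * t ^ (q - 1)) t :=
      Real.hasDerivAt_rpow_const (Or.inl ht.ne')
    have dQ : HasDerivAt (fun τ : ℝ => a / 2 * (1 - q * τ ^ (q - 1)))
        (a / 2 * (q * (1 - q) * t ^ (q - 2))) t := by
      refine ((((Real.hasDerivAt_rpow_const (x := t) (p := q - 1) (Or.inl ht.ne')).const_mul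
        q).const_sub 1).const_mul (a / 2)).congr_deriv ?_
      rw [show q - 1 - 1 = q - 2 by ring]; ring
    have dV := ((hz.sub hζ).const_smul a).add (dP.smul (hv.add (hΓ.const_smul γ)))
    -- Inserting the dynamics eliminates v' and Γ'; as a = α - 1, friction leaves the coefficient q
    -- t ^ (q - 1) - 1 on v.
    have hV : a • (v t - w t) + (t ^ q • (v' t + γ • Γ' t) + (q * t ^ (q - 1)) • (v t + γ • Γ t))
        = (q * t ^ (q - 1) - 1) • v t - a • w t
          - (t ^ (q + s) - γ * q * t ^ (q - 1)) • Γ t := by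
      have h1 : v' t + γ • Γ' t = -((α / t ^ q) • v t) - t ^ s • Γ t := by
        rw [← sub_eq_zero, ← hode]; abel
      have h2 : t ^ q • (α / t ^ q) • v t = α • v t := by
        rw [smul_smul, mul_div_cancel₀ _ hPpos.ne']
      rw [h1, Real.rpow_add ht, ha_def, smul_sub (t ^ q), smul_neg, h2]
      module
    have dV2 := (dV.congr_deriv hV).norm_sq.const_mul (1 / 2)
    have dU := dQ.mul (hz.sub hζ).norm_sq
    -- With P = t ^ q, Q = P' and β the denominator of θ divided by a, both cancellation conditions
    -- hold exactly; they dictate the form of `extrap`.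
    have key := energy_rate_identity hJ (a := a) (γ := γ) (P := t ^ q) (Q := q * t ^ (q - 1))
      (β := t ^ (q + s) - γ * q * t ^ (q - 1)) (σ := gapCoeff γ q s t)
      (θ := extrap α γ q s t) (u := z t - ζ t) (v := v t) (Γ := Γ t)
      (g := A (z t) + (c / t ^ p) • z t + J (ζ t)) (w := w t)
      (by rw [hΓeq, map_add, map_sub, map_smul]; abel)
      (by
        rw [gapCoeff, show 2 * q + s = q + (q + s) by ring, Real.rpow_add ht q,
          show 2 * q - 1 = q + (q - 1) by ring, Real.rpow_add ht q (q - 1)]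
        ring)
      (by
        have h1 : t ^ (q + s) - γ * q * t ^ (q - 1) ≠ 0 := by
          have := Real.rpow_pos_of_pos ht (q + s)
          linarith
        rw [extrap, ← ha_def, gapCoeff]
        exact mul_div_cancel₀ _ (mul_ne_zero ha.ne' h1))
    refine ((d2.add dV2).add dU).congr_deriv ?_
    simp only [E', σ', Pi.sub_apply, Pi.add_apply, Pi.smul_apply, Pi.smul_apply']
    linear_combination key
  obtain ⟨M, hM, hEM⟩ := eventually_le_rpow_of_deriv_le
    (κ := min (min (a / 8) (c / (4 * (3 * a + 1)))) (min (1 / 6) (1 / (6 * γ))))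
    -- The source exponent 3q + s + p - 2 raised by q, the loss caused by damping of strength only t
    -- ^ (-q).
    (r := 4 * q + s + p - 2) (q := q) (E := E) (E' := E')
    (C := (2 * (p * R * (c + ‖J‖)) + a * (p * R) * a + a * (p * R)) ^ 2 / (4 * (a * c / 16))
          + (a * (p * R)) ^ 2 / (4 * (1 / 4)) + (a * (p * R) * γ) ^ 2 / (4 * (γ / 4)))
    (by positivity) hq₁ hE (by
      filter_upwards [hw, hζR, hζeq, hden, eventually_ge_atTop 1, eventually_gapCoeff hγ hq₀ hs,
        eventually_deriv_gapCoeff_le (γ := γ) ha hq₀ hs hq₁,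
        eventually_mul_rpow_le_rpow (a := q - 1) (b := 0) (by linarith) (2 * q),
        eventually_mul_rpow_le_rpow (a := q - 2) (b := q + s - p) (by linarith)
          (8 / c * (q * (1 - q)))] with t hw hζR hζeq hden ht hσ hσ' hQ hμ
      have ht0 : 0 < t := by linarith
      rw [Real.rpow_zero] at hQ
      have hQ0 : 0 ≤ q * t ^ (q - 1) := by positivity
      have hD0 : 0 ≤ opGap φ J (c / t ^ p) (z t) (ζ t) :=
        le_trans (by positivity) (hA.le_opGap hJ hζeq)
      have hσ0 : 0 ≤ gapCoeff γ q s t := le_trans (by positivity) hσ.1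
      have hμ' : a / 2 * (q * (1 - q) * t ^ (q - 2)) ≤ a * c / 16 * t ^ (q + s - p) := by
        calc _ = a * c / 16 * (8 / c * (q * (1 - q)) * t ^ (q - 2)) := by field_simp; ring
          _ ≤ _ := by gcongr
      have h1 := energy_rate_le (J := J) ha hγ hc hp₀ hq₀ hs hR ht hden hσ0 hσ.2 hσ' hQ0
        (by linarith) hμ' (v := v t) (Γ := Γ t) hζR hw hD0 (hA.opGap_add_le hJ _ _ _)
      have h2 := energy_le ha hγ hc hs hq₀ hpq ht hσ.2 hQ0 (u := z t - ζ t) (v := v t)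
        (Γ := Γ t) hD0
      rw [show 4 * q + s + p - 2 - q = 3 * q + s + p - 2 by ring]
      simp only [E', E, σ']
      linarith)
  refine ⟨max (2 * M) (4 * M / a), by positivity, ?_⟩
  filter_upwards [hEM, hζeq, eventually_gt_atTop 0, eventually_gapCoeff hγ hq₀ hs,
    eventually_mul_rpow_le_rpow (a := q - 1) (b := 0) (by linarith) (2 * q)]
    with t hEM hζeq ht0 hσ hQ
  rw [Real.rpow_zero] at hQ
  have hD0 : 0 ≤ opGap φ J (c / t ^ p) (z t) (ζ t) :=
    le_trans (by positivity) (hA.le_opGap hJ hζeq)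
  have hσpos : 0 < t ^ (2 * q + s) := Real.rpow_pos_of_pos ht0 _
  have hσ0 : 0 ≤ gapCoeff γ q s t := le_trans (by positivity) hσ.1
  have hr : 0 < t ^ (4 * q + s + p - 2) := Real.rpow_pos_of_pos ht0 _
  have t1 : 0 ≤ gapCoeff γ q s t * opGap φ J (c / t ^ p) (z t) (ζ t) := by positivity
  have t2 : 0 ≤ 1 / 2 * ‖a • (z t - ζ t) + t ^ q • (v t + γ • Γ t)‖ ^ 2 := by positivity
  have t3 : a / 4 * ‖z t - ζ t‖ ^ 2 ≤ a / 2 * (1 - q * t ^ (q - 1)) * ‖z t - ζ t‖ ^ 2 := by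
    have : a / 2 * (1 / 2) ≤ a / 2 * (1 - q * t ^ (q - 1)) := by gcongr; linarith
    nlinarith [sq_nonneg ‖z t - ζ t‖]
  have t4 : 0 ≤ a / 4 * ‖z t - ζ t‖ ^ 2 := by positivity
  simp only [E] at hEM
  constructor
  · have h1 : t ^ (2 * q + s) / 2 * opGap φ J (c / t ^ p) (z t) (ζ t)
        ≤ M * t ^ (4 * q + s + p - 2) := by
      calc _ ≤ gapCoeff γ q s t * opGap φ J (c / t ^ p) (z t) (ζ t) := by gcongr; exact hσ.1
        _ ≤ _ := by linarith
    rw [show 4 * q + s + p - 2 = (2 * q + s) + (2 * q + p - 2) by ring,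
      Real.rpow_add ht0 (2 * q + s)] at h1
    have h2 : opGap φ J (c / t ^ p) (z t) (ζ t) ≤ 2 * M * t ^ (2 * q + p - 2) := by
      refine le_of_mul_le_mul_left ?_ hσpos
      linarith
    exact h2.trans (by gcongr; exact le_max_left _ _)
  · have h2 : ‖z t - ζ t‖ ^ 2 ≤ 4 * M / a * t ^ (4 * q + s + p - 2) := by
      have h3 : a / 4 * ‖z t - ζ t‖ ^ 2 ≤ M * t ^ (4 * q + s + p - 2) := by linarith
      rw [div_mul_eq_mul_div, le_div_iff₀ ha]
      linarith
    exact h2.trans (by gcongr; exact le_max_right _ _)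

end Decay

/-! ### Gradients of convex functions. -/

section Gradient

variable {F : Type*} [NormedAddCommGroup F] [InnerProductSpace ℝ F] [CompleteSpace F]

theorem differentiable_gradient {f : F → ℝ} (hf : ContDiff ℝ 2 f) :
    Differentiable ℝ (gradient f) := by
  have h1 : Differentiable ℝ (fderiv ℝ f) :=
    (hf.fderiv_right (m := 1) (by norm_num)).differentiable (by norm_num)
  have h2 := ((InnerProductSpace.toDual ℝ F).symm.toContinuousLinearEquiv :
    StrongDual ℝ F ≃L[ℝ] F).differentiable.comp h1
  exact h2

theorem hasFDerivAt_innerSL_gradient {f : F → ℝ} (hf : Differentiable ℝ f) (v : F) :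
    HasFDerivAt f (innerSL ℝ (gradient f v)) v := by
  have h := (hf v).hasGradientAt.hasFDerivAt
  exact h

theorem gradient_eq_of_hasFDerivAt {f : F → ℝ} {v g : F} (h : HasFDerivAt f (innerSL ℝ g) v) :
    gradient f v = g :=
  HasGradientAt.gradient h

/-- On the line through v and w, the secant slope of a convex function is at least its derivative at
the left end. -/
theorem isSubgrad_gradient {f : F → ℝ} (hf : Differentiable ℝ f) (hfc : ConvexOn ℝ univ f) :
    IsSubgrad f (gradient f) := by
  intro v w
  have hl : ConvexOn ℝ univ (fun r : ℝ => f (v + r • (w - v))) := by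
    refine ⟨convex_univ, fun r _ r' _ b b' hb hb' hbb => ?_⟩
    have h1 := hfc.2 (mem_univ (v + r • (w - v))) (mem_univ (v + r' • (w - v))) hb hb' hbb
    have h2 : b • (v + r • (w - v)) + b' • (v + r' • (w - v))
        = v + (b • r + b' • r') • (w - v) := by
      have : b' = 1 - b := by linarith
      subst this
      simp only [smul_eq_mul]
      module
    rwa [h2] at h1
  have hd : HasDerivAt (fun r : ℝ => f (v + r • (w - v))) (inner ℝ (gradient f v) (w - v)) 0 := by
    have h2 : HasDerivAt (fun r : ℝ => v + r • (w - v)) (w - v) 0 := by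
      simpa using ((hasDerivAt_id (0 : ℝ)).smul_const (w - v)).const_add v
    have h3 : HasFDerivAt f (innerSL ℝ (gradient f v)) (v + (0 : ℝ) • (w - v)) := by
      simpa using hasFDerivAt_innerSL_gradient hf v
    exact h3.comp_hasDerivAt 0 h2
  have h := hl.le_slope_of_hasDerivAt (mem_univ 0) (mem_univ 1) one_pos hd
  simp only [slope_def_field, one_smul, zero_smul, sub_zero, div_one, add_zero,
    add_sub_cancel] at h
  linarith

end Gradient

/-! ### Translation to the product space. -/

section Product

/-- Shortcut instance: the direct search is very slow for products of Euclidean spaces. -/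
instance continuousSMul_withLp_prod {X Y : Type*} [NormedAddCommGroup X] [NormedAddCommGroup Y]
    [InnerProductSpace ℝ X] [InnerProductSpace ℝ Y] :
    ContinuousSMul ℝ (WithLp 2 (X × Y)) := inferInstance

variable {n m : ℕ}

/-- The convex potential `(x, y) ↦ f(x) + g(y)`. -/
def prodPotential (f : EuclideanSpace ℝ (Fin n) → ℝ) (g : EuclideanSpace ℝ (Fin m) → ℝ)
    (z : WithLp 2 (EuclideanSpace ℝ (Fin n) × EuclideanSpace ℝ (Fin m))) : ℝ :=
  f z.fst + g z.snd

/-- The gradient of `prodPotential`. -/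
def prodGradient (f : EuclideanSpace ℝ (Fin n) → ℝ) (g : EuclideanSpace ℝ (Fin m) → ℝ)
    (z : WithLp 2 (EuclideanSpace ℝ (Fin n) × EuclideanSpace ℝ (Fin m))) :
    WithLp 2 (EuclideanSpace ℝ (Fin n) × EuclideanSpace ℝ (Fin m)) :=
  WithLp.toLp 2 (gradient f z.fst, gradient g z.snd)

/-- The skew-symmetric operator `(x, y) ↦ (K† y, -K x)`. -/
def coupling (K : EuclideanSpace ℝ (Fin n) →L[ℝ] EuclideanSpace ℝ (Fin m)) :
    WithLp 2 (EuclideanSpace ℝ (Fin n) × EuclideanSpace ℝ (Fin m)) →L[ℝ]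
      WithLp 2 (EuclideanSpace ℝ (Fin n) × EuclideanSpace ℝ (Fin m)) :=
  (WithLp.prodContinuousLinearEquiv 2 ℝ (EuclideanSpace ℝ (Fin n))
      (EuclideanSpace ℝ (Fin m))).symm.toContinuousLinearMap ∘L
    (((ContinuousLinearMap.adjoint K) ∘L WithLp.sndL 2 ℝ _ _).prod
      (-(K ∘L WithLp.fstL 2 ℝ _ _)))

variable {f : EuclideanSpace ℝ (Fin n) → ℝ} {g : EuclideanSpace ℝ (Fin m) → ℝ}
  {K : EuclideanSpace ℝ (Fin n) →L[ℝ] EuclideanSpace ℝ (Fin m)}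

theorem coupling_apply
    (z : WithLp 2 (EuclideanSpace ℝ (Fin n) × EuclideanSpace ℝ (Fin m))) :
    coupling K z = WithLp.toLp 2 (ContinuousLinearMap.adjoint K z.snd, -K z.fst) := rfl

theorem isSkewOp_coupling : IsSkewOp (coupling K) := by
  intro z
  rw [coupling_apply, WithLp.prod_inner_apply]
  simp only [inner_neg_left, ContinuousLinearMap.adjoint_inner_left]
  rw [real_inner_comm]
  exact add_neg_cancel _

theorem isSubgrad_prodGradient (hf : Differentiable ℝ f) (hfc : ConvexOn ℝ univ f)
    (hg : Differentiable ℝ g) (hgc : ConvexOn ℝ univ g) :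
    IsSubgrad (prodPotential f g) (prodGradient f g) := by
  intro v w
  have h1 := isSubgrad_gradient hf hfc v.fst w.fst
  have h2 := isSubgrad_gradient hg hgc v.snd w.snd
  simp only [prodPotential, prodGradient, WithLp.prod_inner_apply, WithLp.ofLp_sub, Prod.fst_sub,
    Prod.snd_sub]
  simp only [WithLp.fst, WithLp.snd] at h1 h2 ⊢
  linarith

theorem hasFDerivAt_prodPotential (hf : Differentiable ℝ f) (hg : Differentiable ℝ g)
    (z : WithLp 2 (EuclideanSpace ℝ (Fin n) × EuclideanSpace ℝ (Fin m))) :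
    HasFDerivAt (prodPotential f g) (innerSL ℝ (prodGradient f g z)) z := by
  have h1 := (hasFDerivAt_innerSL_gradient hf z.fst).comp z (WithLp.fstL 2 ℝ _ _).hasFDerivAt
  have h2 := (hasFDerivAt_innerSL_gradient hg z.snd).comp z (WithLp.sndL 2 ℝ _ _).hasFDerivAt
  refine (h1.add h2).congr_fderiv ?_
  ext w
  rfl

theorem differentiable_prodGradient (hf : ContDiff ℝ 2 f) (hg : ContDiff ℝ 2 g) :
    Differentiable ℝ (prodGradient f g) := by
  have h1 := (differentiable_gradient hf).comp (WithLp.fstL 2 ℝ (EuclideanSpace ℝ (Fin n))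
    (EuclideanSpace ℝ (Fin m))).differentiable
  have h2 := (differentiable_gradient hg).comp (WithLp.sndL 2 ℝ (EuclideanSpace ℝ (Fin n))
    (EuclideanSpace ℝ (Fin m))).differentiable
  let L : EuclideanSpace ℝ (Fin n) × EuclideanSpace ℝ (Fin m) →L[ℝ]
      WithLp 2 (EuclideanSpace ℝ (Fin n) × EuclideanSpace ℝ (Fin m)) :=
    (WithLp.prodContinuousLinearEquiv 2 ℝ (EuclideanSpace ℝ (Fin n))
      (EuclideanSpace ℝ (Fin m))).symm.toContinuousLinearMap
  exact L.differentiable.comp (h1.prodMk h2)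

theorem hasDerivAt_toLp_prod {x : ℝ → EuclideanSpace ℝ (Fin n)} {y : ℝ → EuclideanSpace ℝ (Fin m)}
    {x' : EuclideanSpace ℝ (Fin n)} {y' : EuclideanSpace ℝ (Fin m)} {t : ℝ}
    (hx : HasDerivAt x x' t) (hy : HasDerivAt y y' t) :
    HasDerivAt (fun τ => WithLp.toLp 2 (x τ, y τ)) (WithLp.toLp 2 (x', y')) t := by
  let L : EuclideanSpace ℝ (Fin n) × EuclideanSpace ℝ (Fin m) →L[ℝ]
      WithLp 2 (EuclideanSpace ℝ (Fin n) × EuclideanSpace ℝ (Fin m)) :=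
    (WithLp.prodContinuousLinearEquiv 2 ℝ (EuclideanSpace ℝ (Fin n))
      (EuclideanSpace ℝ (Fin m))).symm.toContinuousLinearMap
  have h : HasFDerivAt L L (x t, y t) := L.hasFDerivAt
  exact h.comp_hasDerivAt t (hx.prodMk hy)

theorem hasFDerivAt_regLagrangian_fst (hf : Differentiable ℝ f) (c p t : ℝ)
    (x : EuclideanSpace ℝ (Fin n)) (y : EuclideanSpace ℝ (Fin m)) :
    HasFDerivAt (fun u => regLagrangian f g K c p t u y)
      (innerSL ℝ (gradient f x + ContinuousLinearMap.adjoint K y + (c / t ^ p) • x)) x := by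
  have h1 := hasFDerivAt_innerSL_gradient hf x
  have h2 : HasFDerivAt (fun u => inner ℝ (K u) y)
      (innerSL ℝ (ContinuousLinearMap.adjoint K y)) x := by
    have h := (innerSL ℝ (ContinuousLinearMap.adjoint K y)).hasFDerivAt (x := x)
    refine h.congr_of_eventuallyEq (Eventually.of_forall fun u => ?_)
    simp only [innerSL_apply_apply, ContinuousLinearMap.adjoint_inner_left]
    exact real_inner_comm _ _
  have h3 := (((hasStrictFDerivAt_norm_sq x).hasFDerivAt.sub_const (‖y‖ ^ 2)).const_mul
    (c / (2 * t ^ p)))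
  refine (((h1.add h2).sub_const (g y)).add h3).congr_fderiv ?_
  ext w
  simp
  ring

theorem hasFDerivAt_regLagrangian_snd (hg : Differentiable ℝ g) (c p t : ℝ)
    (x : EuclideanSpace ℝ (Fin n)) (y : EuclideanSpace ℝ (Fin m)) :
    HasFDerivAt (fun v => regLagrangian f g K c p t x v)
      (innerSL ℝ (K x - gradient g y - (c / t ^ p) • y)) y := by
  have h1 := hasFDerivAt_innerSL_gradient hg y
  have h2 := (innerSL ℝ (K x)).hasFDerivAt (x := y)
  have h3 := (((hasStrictFDerivAt_norm_sq y).hasFDerivAt.const_sub (‖x‖ ^ 2)).const_mul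
    (c / (2 * t ^ p)))
  refine (((h2.const_add (f x)).sub h1).add h3).congr_fderiv ?_
  ext w
  simp
  ring

theorem gradFst_regLagrangian (hf : Differentiable ℝ f) (c p t : ℝ)
    (x : EuclideanSpace ℝ (Fin n)) (y : EuclideanSpace ℝ (Fin m)) :
    gradFst (regLagrangian f g K c p t) x y
      = gradient f x + ContinuousLinearMap.adjoint K y + (c / t ^ p) • x :=
  gradient_eq_of_hasFDerivAt (hasFDerivAt_regLagrangian_fst hf c p t x y)

theorem gradSnd_regLagrangian (hg : Differentiable ℝ g) (c p t : ℝ)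
    (x : EuclideanSpace ℝ (Fin n)) (y : EuclideanSpace ℝ (Fin m)) :
    gradSnd (regLagrangian f g K c p t) x y = K x - gradient g y - (c / t ^ p) • y :=
  gradient_eq_of_hasFDerivAt (hasFDerivAt_regLagrangian_snd hg c p t x y)

/-- Fermat's rule in each variable; the second equation changes sign because y maximizes. -/
theorem IsSaddlePoint.operator_eq_zero (hf : Differentiable ℝ f) (hg : Differentiable ℝ g)
    {c p t : ℝ} {x : EuclideanSpace ℝ (Fin n)} {y : EuclideanSpace ℝ (Fin m)}
    (h : IsSaddlePoint (regLagrangian f g K c p t) x y) :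
    prodGradient f g (WithLp.toLp 2 (x, y)) + (c / t ^ p) • WithLp.toLp 2 (x, y)
      + coupling K (WithLp.toLp 2 (x, y)) = 0 := by
  have h1 := IsLocalMin.hasFDerivAt_eq_zero (Eventually.of_forall fun u => (h u y).2)
    (hasFDerivAt_regLagrangian_fst hf c p t x y)
  have h2 := IsLocalMax.hasFDerivAt_eq_zero (Eventually.of_forall fun v => (h x v).1)
    (hasFDerivAt_regLagrangian_snd hg c p t x y)
  have h3 := congrArg (fun L => ‖L‖) h1
  have h4 := congrArg (fun L => ‖L‖) h2
  simp only [innerSL_apply_norm, norm_zero, norm_eq_zero] at h3 h4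
  rw [coupling_apply, prodGradient, ← WithLp.toLp_smul, ← WithLp.toLp_add, ← WithLp.toLp_add,
    WithLp.toLp_eq_zero]
  ext1
  · simp only [Prod.smul_mk, Prod.mk_add_mk, Prod.fst_zero, WithLp.toLp_fst, WithLp.toLp_snd]
    rw [← h3]; abel
  · simp only [Prod.smul_mk, Prod.mk_add_mk, Prod.snd_zero, WithLp.toLp_fst, WithLp.toLp_snd]
    rw [← neg_eq_zero, ← h4]; abel

theorem mem_saddleSet_iff (hf : Differentiable ℝ f) (hfc : ConvexOn ℝ univ f)
    (hg : Differentiable ℝ g) (hgc : ConvexOn ℝ univ g)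
    (z : WithLp 2 (EuclideanSpace ℝ (Fin n) × EuclideanSpace ℝ (Fin m))) :
    z ∈ saddleSet (lagrangian f g K) ↔ prodGradient f g z + coupling K z = 0 := by
  constructor
  · intro h
    -- With c = 0 the regularization vanishes, so the regularized statement covers L itself.
    have h0 : regLagrangian f g K 0 1 1 = lagrangian f g K := by
      ext x y; simp [regLagrangian]
    have h1 : IsSaddlePoint (regLagrangian f g K 0 1 1) z.fst z.snd := by rw [h0]; exact h
    have h2 := h1.operator_eq_zero hf hg
    rwa [zero_div, zero_smul, add_zero] at h2
  · intro h u v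
    have e1 : gradient f z.fst = -ContinuousLinearMap.adjoint K z.snd :=
      eq_neg_of_add_eq_zero_left (congrArg WithLp.fst h)
    have e2 : gradient g z.snd = K z.fst := by
      have := eq_neg_of_add_eq_zero_left (congrArg WithLp.snd h)
      simpa [prodGradient, coupling_apply] using this
    have h1 := isSubgrad_gradient hf hfc z.fst u
    have h2 := isSubgrad_gradient hg hgc z.snd v
    rw [e1, inner_neg_left, ContinuousLinearMap.adjoint_inner_left, map_sub, inner_sub_right,
      real_inner_comm, real_inner_comm _ z.snd] at h1
    rw [e2, inner_sub_right] at h2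
    simp only [lagrangian]
    constructor <;> linarith

/-- The bilinear terms ⟪Kx, y'⟫ - ⟪Kx', y⟫ are the pairing of J (x', y') with (x, y). -/
theorem regLagrangian_sub_eq_opGap (c p t : ℝ) (x x' : EuclideanSpace ℝ (Fin n))
    (y y' : EuclideanSpace ℝ (Fin m)) :
    regLagrangian f g K c p t x y' - regLagrangian f g K c p t x' y
      = opGap (prodPotential f g) (coupling K) (c / t ^ p) (WithLp.toLp 2 (x, y))
          (WithLp.toLp 2 (x', y')) := by
  rw [opGap, coupling_apply, WithLp.prod_inner_apply, WithLp.prod_norm_sq_eq_of_L2,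
    WithLp.prod_norm_sq_eq_of_L2]
  simp only [prodPotential, regLagrangian, lagrangian, WithLp.toLp_fst, WithLp.toLp_snd,
    inner_neg_left, ContinuousLinearMap.adjoint_inner_left]
  rw [real_inner_comm (K x) y']
  ring

end Product

/-! ### The trajectory in the product space. -/

section Main

variable {n m : ℕ} {f : EuclideanSpace ℝ (Fin n) → ℝ} {g : EuclideanSpace ℝ (Fin m) → ℝ}
  {K : EuclideanSpace ℝ (Fin n) →L[ℝ] EuclideanSpace ℝ (Fin m)}

theorem projZero_eq_singleton {H : Type*} [NormedAddCommGroup H] {D : Set H} {v : H} (hv : v ∈ D)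
    (h : ∀ w ∈ D, ‖v‖ ^ 2 + ‖w - v‖ ^ 2 ≤ ‖w‖ ^ 2) : projZero D = {v} := by
  ext w
  refine ⟨fun hw => ?_, ?_⟩
  · have h1 := h w hw.1
    have h2 := pow_le_pow_left₀ (norm_nonneg w) (hw.2 v hv) 2
    have h3 : ‖w - v‖ = 0 := by nlinarith [norm_nonneg (w - v)]
    exact sub_eq_zero.1 (norm_eq_zero.1 h3)
  · rintro rfl
    refine ⟨hv, fun u hu => ?_⟩
    have h1 := h u hu
    exact le_of_sq_le_sq (by nlinarith [sq_nonneg ‖u - w‖]) (norm_nonneg _)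

theorem differentiableAt_extrap {α γ q s t : ℝ} (ht : 0 < t)
    (h : (α - 1) * (t ^ (q + s) - γ * q * t ^ (q - 1)) ≠ 0) :
    DifferentiableAt ℝ (extrap α γ q s) t := by
  have hr : ∀ e : ℝ, DifferentiableAt ℝ (fun τ : ℝ => τ ^ e) t := fun e =>
    (Real.hasDerivAt_rpow_const (Or.inl ht.ne')).differentiableAt
  exact (((hr _).sub ((hr _).const_mul _)).add ((hr _).const_mul _)).div
    (((hr _).sub ((hr _).const_mul _)).const_mul _) h

/-- The bracket is t ^ (q - 1) (t ^ (s + 1) - γ q), and the lower bound on t₀ makes the second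
factor positive. -/
theorem extrapDenom_ne_zero {α γ q s t₀ t : ℝ} (hα : 1 < α) (hγ : 0 < γ) (hq : 0 < q)
    (hs : 0 < s) (ht₀ : (γ * q) ^ (1 / (s + 1)) < t₀) (ht : t₀ ≤ t) :
    (α - 1) * (t ^ (q + s) - γ * q * t ^ (q - 1)) ≠ 0 := by
  have hb : 0 < (γ * q) ^ (1 / (s + 1)) := by positivity
  have ht0 : 0 < t := by linarith
  have h1 : γ * q < t ^ (s + 1) := by
    have h := Real.rpow_lt_rpow hb.le (ht₀.trans_le ht) (by linarith : 0 < s + 1)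
    rwa [← Real.rpow_mul (by positivity), one_div, inv_mul_cancel₀ (by linarith),
      Real.rpow_one] at h
  have h2 : t ^ (q + s) = t ^ (s + 1) * t ^ (q - 1) := by
    rw [← Real.rpow_add ht0]; congr 1; ring
  have h3 : 0 < t ^ (q - 1) := Real.rpow_pos_of_pos ht0 _
  refine mul_ne_zero (by linarith) ?_
  rw [h2, ← sub_mul]
  exact mul_ne_zero (by linarith) h3.ne'

/-- The dynamics as a single second-order equation in the product space. -/
theorem IsGlobalSolution.product_equation (hf : ContDiff ℝ 2 f) (hg : ContDiff ℝ 2 g)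
    {α γ q s c p t₀ : ℝ} (hα : 1 < α) (hγ : 0 < γ) (hq : 0 < q) (hs : 0 < s) (ht₀ : 0 < t₀)
    (ht₀' : (γ * q) ^ (1 / (s + 1)) < t₀)
    {x : ℝ → EuclideanSpace ℝ (Fin n)} {y : ℝ → EuclideanSpace ℝ (Fin m)}
    (h : IsGlobalSolution f g K α γ q s c p t₀ x y) :
    ∃ v v' Γ Γ' : ℝ → WithLp 2 (EuclideanSpace ℝ (Fin n) × EuclideanSpace ℝ (Fin m)),
      ∀ t, t₀ < t →
        HasDerivAt (fun τ => WithLp.toLp 2 (x τ, y τ)) (v t) t ∧ HasDerivAt v (v' t) t ∧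
        HasDerivAt Γ (Γ' t) t ∧
        v' t + (α / t ^ q) • v t + γ • Γ' t + t ^ s • Γ t = 0 ∧
        Γ t = prodGradient f g (WithLp.toLp 2 (x t, y t))
          + (c / t ^ p) • WithLp.toLp 2 (x t, y t)
          + coupling K (WithLp.toLp 2 (x t, y t) + extrap α γ q s t • v t) := by
  have hfd : Differentiable ℝ f := hf.differentiable (by norm_num)
  have hgd : Differentiable ℝ g := hg.differentiable (by norm_num)
  set x₁ := derivWithin x (Ici t₀) with hx₁
  set y₁ := derivWithin y (Ici t₀) with hy₁
  set x₂ := derivWithin x₁ (Ici t₀) with hx₂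
  set y₂ := derivWithin y₁ (Ici t₀) with hy₂
  set G : ℝ → EuclideanSpace ℝ (Fin n) := fun τ => gradFst (regLagrangian f g K c p τ) (x τ)
    (y τ + extrap α γ q s τ • y₁ τ) with hG
  set B : ℝ → EuclideanSpace ℝ (Fin m) := fun τ => gradSnd (regLagrangian f g K c p τ)
    (x τ + extrap α γ q s τ • x₁ τ) (y τ) with hB
  -- The second component of Γ is minus the y-gradient, as y maximizes. Each gradient is
  -- extrapolated only in the other variable, so θ appears only inside J.
  refine ⟨fun t => WithLp.toLp 2 (x₁ t, y₁ t), fun t => WithLp.toLp 2 (x₂ t, y₂ t),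
    fun t => WithLp.toLp 2 (G t, -B t),
    fun t => WithLp.toLp 2 (derivWithin G (Ici t₀) t, -derivWithin B (Ici t₀) t), fun t ht => ?_⟩
  have hnhds : Ici t₀ ∈ 𝓝 t := Ici_mem_nhds ht
  have ht0 : 0 < t := ht₀.trans ht
  have key : ∀ {E : Type} [NormedAddCommGroup E] [NormedSpace ℝ E] {k : ℝ → E},
      DifferentiableAt ℝ k t → HasDerivAt k (derivWithin k (Ici t₀) t) t := by
    intro E _ _ k hk
    rw [derivWithin_of_mem_nhds hnhds]
    exact hk.hasDerivAt
  have dx : DifferentiableAt ℝ x t := (h.differentiable_x t ht.le).differentiableAt hnhds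
  have dy : DifferentiableAt ℝ y t := (h.differentiable_y t ht.le).differentiableAt hnhds
  have dx₁ : DifferentiableAt ℝ x₁ t := (h.differentiable_deriv_x t ht.le).differentiableAt hnhds
  have dy₁ : DifferentiableAt ℝ y₁ t := (h.differentiable_deriv_y t ht.le).differentiableAt hnhds
  have dθ : DifferentiableAt ℝ (extrap α γ q s) t :=
    differentiableAt_extrap ht0 (extrapDenom_ne_zero hα hγ hq hs ht₀' ht.le)
  have dε : DifferentiableAt ℝ (fun τ : ℝ => c / τ ^ p) t :=
    (hasDerivAt_const_div_rpow c p ht0).differentiableAt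
  have eG : G = fun τ => gradient f (x τ)
      + ContinuousLinearMap.adjoint K (y τ + extrap α γ q s τ • y₁ τ) + (c / τ ^ p) • x τ := by
    ext1 τ; exact gradFst_regLagrangian hfd _ _ _ _ _
  have eB : B = fun τ => K (x τ + extrap α γ q s τ • x₁ τ) - gradient g (y τ)
      - (c / τ ^ p) • y τ := by
    ext1 τ; exact gradSnd_regLagrangian hgd _ _ _ _ _
  have dG : DifferentiableAt ℝ G t := by
    rw [eG]
    exact (((differentiable_gradient hf (x t)).comp t dx).add
      ((ContinuousLinearMap.adjoint K).differentiableAt.comp t (dy.add (dθ.smul dy₁)))).add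
      (dε.smul dx)
  have dB : DifferentiableAt ℝ B t := by
    rw [eB]
    exact ((K.differentiableAt.comp t (dx.add (dθ.smul dx₁))).sub
      ((differentiable_gradient hg (y t)).comp t dy)).sub (dε.smul dy)
  refine ⟨hasDerivAt_toLp_prod (key dx) (key dy), hasDerivAt_toLp_prod (key dx₁) (key dy₁),
    hasDerivAt_toLp_prod (key dG) (key dB).neg, ?_, ?_⟩
  · simp only [← WithLp.toLp_smul, ← WithLp.toLp_add, WithLp.toLp_eq_zero, Prod.smul_mk,
      Prod.mk_add_mk, smul_neg, ← sub_eq_add_neg]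
    exact Prod.ext (h.eq_x t ht.le) (h.eq_y t ht.le)
  · rw [coupling_apply, prodGradient]
    simp only [eG, eB, ← WithLp.toLp_smul, ← WithLp.toLp_add, Prod.smul_mk, Prod.mk_add_mk,
      WithLp.toLp_fst, WithLp.toLp_snd]
    congr 2
    · abel
    · abel

theorem isBigO_one_div_rpow {u : ℝ → ℝ} {M e e' : ℝ} (he : e ≤ -e')
    (hu : ∀ᶠ t in atTop, 0 ≤ u t) (h : ∀ᶠ t in atTop, u t ≤ M * t ^ e) (hM : 0 ≤ M) :
    u =O[atTop] fun t => 1 / t ^ e' := by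
  refine IsBigO.of_bound M ?_
  filter_upwards [hu, h, eventually_ge_atTop 1] with t h1 h2 h3
  have ht0 : 0 < t := by linarith
  rw [Real.norm_of_nonneg h1, one_div, ← Real.rpow_neg ht0.le,
    Real.norm_of_nonneg (Real.rpow_nonneg ht0.le _)]
  exact h2.trans (by gcongr)

end Main
end SaddleDynamics
end

/-! ### Assembly of the theorem. -/

open SaddleDynamics in
theorem theorem2 {n m : ℕ}
    (f : EuclideanSpace ℝ (Fin n) → ℝ) (g : EuclideanSpace ℝ (Fin m) → ℝ)
    (K : EuclideanSpace ℝ (Fin n) →L[ℝ] EuclideanSpace ℝ (Fin m))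
    (hf : ContDiff ℝ 2 f) (hfc : ConvexOn ℝ univ f)
    (hg : ContDiff ℝ 2 g) (hgc : ConvexOn ℝ univ g)
    (hΩ : (SaddleDynamics.saddleSet (SaddleDynamics.lagrangian f g K)).Nonempty)
    (α γ q s c p t₀ : ℝ) (hα : 1 < α) (hγ : 0 < γ) (hq₀ : 0 < q) (hq₁ : q < 1)
    (hs : 0 < s) (hc : 0 < c) (ht₀ : 0 < t₀) (ht₀' : (γ * q) ^ (1 / (s + 1)) < t₀)
    (hp₀ : 0 < p) (hp₁ : p < 1) (h₁ : p - 2 * q - s < 0) (h₂ : 4 * q + s + p - 2 < 0)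
    (h₃ : 3 * q + s - p - 1 < 0)
    (x : ℝ → EuclideanSpace ℝ (Fin n)) (y : ℝ → EuclideanSpace ℝ (Fin m))
    (hxy : SaddleDynamics.IsGlobalSolution f g K α γ q s c p t₀ x y)
    (xs : ℝ → EuclideanSpace ℝ (Fin n)) (ys : ℝ → EuclideanSpace ℝ (Fin m))
    (hsaddle : ∀ t, t₀ ≤ t →
      SaddleDynamics.IsSaddlePoint (SaddleDynamics.regLagrangian f g K c p t) (xs t) (ys t)) :
    (∃ z : WithLp 2 (EuclideanSpace ℝ (Fin n) × EuclideanSpace ℝ (Fin m)),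
      SaddleDynamics.projZero
          (SaddleDynamics.saddleSet (SaddleDynamics.lagrangian f g K)) = {z} ∧
        Tendsto (fun t => ‖WithLp.toLp 2 (x t, y t) - z‖) atTop (𝓝 0)) ∧
    (1 ≤ q + 2 * p →
      ((fun t => SaddleDynamics.regLagrangian f g K c p t (x t) (ys t)
          - SaddleDynamics.regLagrangian f g K c p t (xs t) (y t))
        =O[atTop] fun t => 1 / t ^ (2 - 2 * q - p)) ∧
      ((fun t => ‖x t - xs t‖ + ‖y t - ys t‖)
        =O[atTop] fun t => 1 / t ^ (1 - 2 * q - (s + p) / 2))) ∧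
    (q + 2 * p < 1 →
      ((fun t => SaddleDynamics.regLagrangian f g K c p t (x t) (ys t)
          - SaddleDynamics.regLagrangian f g K c p t (xs t) (y t))
        =O[atTop] fun t => 1 / t ^ (1 - q + p)) ∧
      ((fun t => ‖x t - xs t‖ + ‖y t - ys t‖)
        =O[atTop] fun t => 1 / t ^ ((1 + p - s) / 2 - 3 / 2 * q))) := by
  have hfd : Differentiable ℝ f := hf.differentiable (by norm_num)
  have hgd : Differentiable ℝ g := hg.differentiable (by norm_num)
  have hA := isSubgrad_prodGradient hfd hfc hgd hgc
  have hJ : IsSkewOp (coupling K) := isSkewOp_coupling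
  have hAd := differentiable_prodGradient hf hg
  set ζ : ℝ → WithLp 2 (EuclideanSpace ℝ (Fin n) × EuclideanSpace ℝ (Fin m)) :=
    fun t => WithLp.toLp 2 (xs t, ys t) with hζ_def
  set z : ℝ → WithLp 2 (EuclideanSpace ℝ (Fin n) × EuclideanSpace ℝ (Fin m)) :=
    fun t => WithLp.toLp 2 (x t, y t) with hz_def
  have hζeq : ∀ t, t₀ ≤ t →
      prodGradient f g (ζ t) + (c / t ^ p) • ζ t + coupling K (ζ t) = 0 :=
    fun t ht => (hsaddle t ht).operator_eq_zero hfd hgd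
  have hζeq' : ∀ᶠ t in atTop,
      prodGradient f g (ζ t) + (c / t ^ p) • ζ t + coupling K (ζ t) = 0 :=
    (eventually_ge_atTop t₀).mono hζeq
  have hεpos : ∀ t, t₀ ≤ t → 0 < c / t ^ p := fun t ht =>
    div_pos hc (Real.rpow_pos_of_pos (ht₀.trans_le ht) _)
  obtain ⟨w₀, hw₀⟩ := hΩ
  obtain ⟨zbar, hzbar, hmin, hlim⟩ := hA.isMonotoneOp.exists_tendsto hJ hAd.continuous
    (ε := fun t => c / t ^ p) (z := ζ)
    ⟨w₀, (mem_saddleSet_iff hfd hfc hgd hgc w₀).1 hw₀⟩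
    ((eventually_ge_atTop t₀).mono hεpos)
    (tendsto_const_nhds.div_atTop (tendsto_rpow_atTop hp₀)) hζeq'
  have hζR : ∀ t, t₀ ≤ t → ‖ζ t‖ ≤ ‖zbar‖ := fun t ht =>
    norm_le_of_inner_sub_nonpos
      (hA.isMonotoneOp.inner_sub_nonpos hJ (hεpos t ht) (hζeq t ht) hzbar)
  -- Two-sided differentiability requires t₀ < t; the bound is |ε'| / ε = p / t times ‖zbar‖.
  have hw : ∀ t, ∃ w, t₀ < t → HasDerivAt ζ w t ∧ ‖w‖ ≤ p * ‖zbar‖ / t := by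
    intro t
    by_cases ht : t₀ < t
    · have ht0 : 0 < t := ht₀.trans ht
      have hn : ∀ᶠ τ in 𝓝 t, t₀ ≤ τ := Ici_mem_nhds ht
      obtain ⟨w, hw1, hw2⟩ := hA.isMonotoneOp.exists_hasDerivAt hJ hAd
        (ε := fun τ => c / τ ^ p) (z := ζ) (hεpos t ht.le) (hasDerivAt_const_div_rpow c p ht0) (hn.mono hζeq) (hn.mono hζR)
      refine ⟨w, fun _ => ⟨hw1, ?_⟩⟩
      have htp : 0 < t ^ p := Real.rpow_pos_of_pos ht0 _
      rw [abs_neg, abs_of_nonneg (by positivity), Real.rpow_sub ht0, Real.rpow_neg ht0.le,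
        Real.rpow_one] at hw2
      refine le_of_mul_le_mul_left (hw2.trans_eq ?_) (hεpos t ht.le)
      field_simp
    · exact ⟨0, fun h => absurd h ht⟩
  choose w hw using hw
  obtain ⟨v, v', Γ, Γ', hdyn⟩ := hxy.product_equation hf hg hα hγ hq₀ hs ht₀ ht₀'
  have hev := eventually_gt_atTop t₀
  obtain ⟨M, hM, hdecay⟩ := eventually_opGap_le (hasFDerivAt_prodPotential hfd hgd) hA hJ hα hγ
    hq₀ hq₁ hs hc hp₀ hp₁ h₁ (norm_nonneg zbar) (hev.mono fun t ht => (hdyn t ht).1)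
    (hev.mono fun t ht => (hdyn t ht).2.1) (hev.mono fun t ht => (hdyn t ht).2.2.1)
    (hev.mono fun t ht => (hdyn t ht).2.2.2.1) (hev.mono fun t ht => (hdyn t ht).2.2.2.2)
    (hev.mono fun t ht => (hw t ht).1) (hev.mono fun t ht => (hw t ht).2)
    ((eventually_ge_atTop t₀).mono hζR) hζeq'
  have hdist : ∀ᶠ t in atTop, ‖z t - ζ t‖ ≤ √M * t ^ ((4 * q + s + p - 2) / 2) := by
    filter_upwards [hdecay, eventually_gt_atTop 0] with t h ht0
    refine le_of_sq_le_sq ?_ (by positivity)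
    rw [mul_pow, Real.sq_sqrt hM.le, ← Real.rpow_natCast (t ^ _), ← Real.rpow_mul ht0.le]
    have e : (4 * q + s + p - 2) / 2 * ((2 : ℕ) : ℝ) = 4 * q + s + p - 2 := by push_cast; ring
    rw [e]
    exact h.2
  have hgap0 : ∀ᶠ t in atTop, 0 ≤ regLagrangian f g K c p t (x t) (ys t)
      - regLagrangian f g K c p t (xs t) (y t) := by
    filter_upwards [eventually_ge_atTop t₀] with t ht
    have := (hsaddle t ht (x t) (y t))
    linarith
  have hgap : ∀ᶠ t in atTop, regLagrangian f g K c p t (x t) (ys t)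
      - regLagrangian f g K c p t (xs t) (y t) ≤ M * t ^ (2 * q + p - 2) := by
    filter_upwards [hdecay] with t h
    rw [regLagrangian_sub_eq_opGap]
    exact h.1
  have hsum : ∀ᶠ t in atTop, ‖x t - xs t‖ + ‖y t - ys t‖
      ≤ 2 * √M * t ^ ((4 * q + s + p - 2) / 2) := by
    filter_upwards [hdist] with t h
    have e : ‖z t - ζ t‖ ^ 2 = ‖x t - xs t‖ ^ 2 + ‖y t - ys t‖ ^ 2 :=
      WithLp.prod_norm_sq_eq_of_L2 _
    have h1 : ‖x t - xs t‖ ≤ ‖z t - ζ t‖ :=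
      le_of_sq_le_sq (by rw [e]; nlinarith [sq_nonneg ‖y t - ys t‖]) (norm_nonneg _)
    have h2 : ‖y t - ys t‖ ≤ ‖z t - ζ t‖ :=
      le_of_sq_le_sq (by rw [e]; nlinarith [sq_nonneg ‖x t - xs t‖]) (norm_nonneg _)
    linarith
  have hsum0 : ∀ᶠ t : ℝ in atTop, 0 ≤ ‖x t - xs t‖ + ‖y t - ys t‖ :=
    Eventually.of_forall fun t => by positivity
  refine ⟨⟨zbar, projZero_eq_singleton ((mem_saddleSet_iff hfd hfc hgd hgc zbar).2 hzbar)
    fun w hw => hmin w ((mem_saddleSet_iff hfd hfc hgd hgc w).1 hw), ?_⟩, fun _ => ?_, fun h => ?_⟩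
  -- The condition 4q + s + p - 2 < 0 makes the distance to the path vanish, while the path tends to
  -- `zbar`.
  · have h1 : Tendsto (fun t => z t - ζ t) atTop (𝓝 0) := by
      refine squeeze_zero_norm' hdist ?_
      have h2 := (tendsto_rpow_neg_atTop (y := -((4 * q + s + p - 2) / 2))
        (by linarith)).const_mul √M
      simpa using h2
    have h2 := (h1.add hlim).sub_const zbar
    simpa using h2.norm
  · exact ⟨isBigO_one_div_rpow (by linarith) hgap0 hgap hM.le,
      isBigO_one_div_rpow (by linarith) hsum0 hsum (by positivity)⟩
  -- For q + 2p < 1 the claimed decay exponents are smaller than those already proved.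
  · exact ⟨isBigO_one_div_rpow (by linarith) hgap0 hgap hM.le,
      isBigO_one_div_rpow (by linarith) hsum0 hsum (by positivity)⟩
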